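/- For $|k|<1$ let $\mathbf K(k)=\int_0^1\frac{du}{\sqrt{(1-u^2)(1-k^2u^2)}}$ be the complete elliptic integral of the first kind with modulus $k$, and for $a>b>0$ put $$\mathbf K_{+}=\mathbf K\!\left(\frac{\sqrt a+\sqrt b}{\sqrt{2(a+b)}}\right),\qquad \mathbf K_{-}=\mathbf K\!\left(\frac{\sqrt a-\sqrt b}{\sqrt{2(a+b)}}\right).$$ Let $\mathrm F_D^{(n)}(\alpha;\beta;\gamma\mid x_1,\dots,x_n)$ denote the Lauricella function with all $n$ parameters of type $\beta$ equal, that is, the holomorphic continuation to $(\mathbb C\setminus[1,\infty))^n$ of the series $$\sum_{m_1,\dots,m_n\ge 0}\frac{(\alpha)_{m_1+\cdots+m_n}(\beta)_{m_1}\cdots(\beta)_{m_n}}{(\gamma)_{m_1+\cdots+m_n}\,m_1!\cdots m_n!}\,x_1^{m_1}\cdots x_n^{m_n}\qquad(|x_1|<1,\dots,|x_n|<1),$$ where $(\lambda)_m=\lambda(\lambda+1)\cdots(\lambda+m-1)$ and $i=\sqrt{-1}$. Then for all real numbers $a>b>0$ the following six formulae hold: $$\pi=\frac{4}{\sqrt{ab(a+b)}}\,\frac{\mathbf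 K_{-}}{\mathrm F_D^{(4)}\left(\tfrac32;\tfrac12;2\mid 1+ia,1-ia,1+ib,1-ib\right)},$$ $$\pi=\frac{4}{\sqrt{a+b}}\,\frac{\mathbf K_{-}}{\mathrm F_D^{(4)}\left(\tfrac12;\tfrac12;2\mid 1+ia,1-ia,1+ib,1-ib\right)},$$ $$\pi=\frac{2\sqrt{a-b}}{\sqrt b}\,\frac{\mathbf K_{+}-\mathbf K_{-}}{\mathrm F_D^{(3)}\left(\tfrac12;\tfrac12;2\mid \tfrac12,\tfrac{b}{a+b},\tfrac{b}{b-a}\right)},$$ $$\pi=\frac{\sqrt{a-b}}{\sqrt a}\,\frac{\mathbf K_{+}+\mathbf K_{-}}{\mathrm F_D^{(3)}\left(\tfrac12;\tfrac12;1\mid \tfrac12,\tfrac{b}{a+b},\tfrac{b}{b-a}\right)},$$ $$\pi=\frac{\sqrt a}{\sqrt{2(a+b)}}\,\frac{\mathbf K_{+}+\mathbf K_{-}}{\mathrm F_D^{(3)}\left(\tfrac12;\tfrac12;1\mid -1,\tfrac ba,-\tfrac ba\right)},$$ $$\pi=\frac{\sqrt2\,a}{\sqrt{b(a+b)}}\,\frac{\mathbf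 K_{+}-\mathbf K_{-}}{\mathrm F_D^{(3)}\left(\tfrac32;\tfrac12;2\mid -1,\tfrac ba,-\tfrac ba\right)}.$$ -/

import Mathlib

/-- The complete elliptic integral of the first kind as a function of the modulus `k`
(to be used for `|k| < 1`): `K(k) = ∫₀¹ du / √((1 - u²)(1 - k²u²))`. -/
noncomputable def ellipticK (k : ℝ) : ℝ :=
  ∫ u in (0 : ℝ)..1, 1 / Real.sqrt ((1 - u ^ 2) * (1 - k ^ 2 * u ^ 2))

/-- `K₊^{(a,b)} = K((√a + √b) / √(2(a+b)))`. -/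
noncomputable def ellipticKPlus (a b : ℝ) : ℝ :=
  ellipticK ((Real.sqrt a + Real.sqrt b) / Real.sqrt (2 * (a + b)))

/-- `K₋^{(a,b)} = K((√a - √b) / √(2(a+b)))`. -/
noncomputable def ellipticKMinus (a b : ℝ) : ℝ :=
  ellipticK ((Real.sqrt a - Real.sqrt b) / Real.sqrt (2 * (a + b)))

/-- The Pochhammer symbol `(z)_m = z (z+1) ⋯ (z+m-1)`. -/
noncomputable def pochhammerSymbol (z : ℂ) (m : ℕ) : ℂ :=
  (ascPochhammer ℂ m).eval z

/-- The term of multi-index `m` in the Lauricella series `F_D^{(n)}(a; b₁, …, bₙ; c | x₁, …, xₙ)`. -/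
noncomputable def lauricellaTerm {n : ℕ} (a : ℂ) (b : Fin n → ℂ) (c : ℂ) (x : Fin n → ℂ)
    (m : Fin n → ℕ) : ℂ :=
  pochhammerSymbol a (∑ i, m i) * (∏ i, pochhammerSymbol (b i) (m i)) /
    (pochhammerSymbol c (∑ i, m i) * ∏ i, ((m i).factorial : ℂ)) * ∏ i, x i ^ m i

/-- The Lauricella series, summed over all multi-indices; it converges absolutely on the unit
polydisc `|x₁| < 1, …, |xₙ| < 1` (for `c` not a non-positive integer). -/
noncomputable def lauricellaSeries {n : ℕ} (a : ℂ) (b : Fin n → ℂ) (c : ℂ) (x : Fin n → ℂ) : ℂ :=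
  ∑' m : Fin n → ℕ, lauricellaTerm a b c x m

/-- The domain of the principal branch of `F_D^{(n)}`: the points of `ℂⁿ` none of whose coordinates
lies on the real half-line `[1, ∞)`. It is open, star-shaped about `0`, and contains the unit
polydisc. -/
def lauricellaDomain (n : ℕ) : Set (Fin n → ℂ) :=
  {x | ∀ i, 1 - x i ∈ Complex.slitPlane}

/-- `F` is an analytic continuation of the Lauricella series to the cut domain: it is holomorphic
there and coincides with the sum of the series on the unit polydisc. By the identity theorem this
determines `F` on `lauricellaDomain n`. -/
def IsLauricellaContinuation {n : ℕ} (a : ℂ) (b : Fin n → ℂ) (c : ℂ)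
    (F : (Fin n → ℂ) → ℂ) : Prop :=
  DifferentiableOn ℂ F (lauricellaDomain n) ∧
    ∀ x : Fin n → ℂ, (∀ i, ‖x i‖ < 1) → F x = lauricellaSeries a b c x

open Classical in
/-- The Lauricella function `F_D^{(n)}(a; b₁, …, bₙ; c | x₁, …, xₙ)`: the value at `x` of the
analytic continuation of the Lauricella series to the cut domain (and `0` by convention at points
outside that domain, or if there is no such continuation). -/
noncomputable def lauricellaFD {n : ℕ} (a : ℂ) (b : Fin n → ℂ) (c : ℂ) (x : Fin n → ℂ) : ℂ :=
  if h : x ∈ lauricellaDomain n ∧ ∃ F : (Fin n → ℂ) → ℂ, IsLauricellaContinuation a b c F then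
    h.2.choose x
  else 0

/-! The Lauricella function is Euler's integral of `t ^ (α - 1) * (1 - t) ^ (γ - α - 1) *
∏ i, (1 - x i * t) ^ (-β i)` over `(0, 1)`, divided by `B(α, γ - α)`, and the substitution
`t ↦ 1 - t` turns it into the Pfaff transformation `x ↦ x / (x - 1)`, `α ↦ γ - α`. Up to that
transformation, the integrals of the theorem are of two kinds. Three variables give the periods of
`t ^ j / w dt`, `j = 0, 1`, on the genus two curve `w ^ 2 = t * (1 - t ^ 2) * (1 - k ^ 2 * t ^ 2)`
with `k = b / a`; for each sign of `s = ±√k` this curve covers an elliptic curve with degree two,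
so that `K₊` and `K₋` are combinations of its two periods. Four variables give, with
`t = 1 / (1 + w ^ 2)`, the integral of `w ^ 2 / √((w ^ 4 + a ^ 2) * (w ^ 4 + b ^ 2))` over
`(0, ∞)`; in terms of `v = w - √(a * b) / w` its integrand has a biquadratic under the root, and
the Cauchy–Schlömilch transformation identifies it with a multiple of `K₋`. -/

open MeasureTheory Set Filter Topology

section PowerSeries

theorem pochhammerSymbol_div_factorial (z : ℂ) (m : ℕ) :
    pochhammerSymbol z m / (m.factorial : ℂ) = Ring.choose (z + m - 1) m := by
  have h := Ring.factorial_nsmul_multichoose_eq_ascPochhammer z m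
  rw [Polynomial.ascPochhammer_smeval_eq_eval, Ring.multichoose_eq, nsmul_eq_mul] at h
  rw [pochhammerSymbol, ← h, mul_div_cancel_left₀]
  exact_mod_cast m.factorial_ne_zero

theorem mem_eball_zero_one_of_norm_lt_one {z : ℂ} (hz : ‖z‖ < 1) : z ∈ Metric.eball (0 : ℂ) 1 := by
  rw [← ENNReal.ofReal_one, Metric.eball_ofReal]
  exact mem_ball_zero_iff.2 hz

theorem summable_norm_pochhammerSymbol_mul_pow (β : ℂ) {z : ℂ} (hz : ‖z‖ < 1) :
    Summable fun m : ℕ ↦ ‖pochhammerSymbol β m / (m.factorial : ℂ) * z ^ m‖ := by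
  have h := Complex.one_div_one_sub_cpow_hasFPowerSeriesOnBall_zero β
  refine (FormalMultilinearSeries.summable_norm_apply _
    (Metric.eball_subset_eball h.r_le (mem_eball_zero_one_of_norm_lt_one hz))).congr fun m ↦ ?_
  rw [pochhammerSymbol_div_factorial]
  simp [FormalMultilinearSeries.ofScalars]

theorem hasSum_pochhammerSymbol_mul_pow (β : ℂ) {z : ℂ} (hz : ‖z‖ < 1) :
    HasSum (fun m : ℕ ↦ pochhammerSymbol β m / (m.factorial : ℂ) * z ^ m) ((1 - z) ^ (-β)) := by
  have h := (Complex.one_div_one_sub_cpow_hasFPowerSeriesOnBall_zero β).hasSum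
    (mem_eball_zero_one_of_norm_lt_one hz)
  rw [zero_add, one_div, ← Complex.cpow_neg] at h
  refine h.congr_fun fun m ↦ ?_
  rw [pochhammerSymbol_div_factorial]
  simp [FormalMultilinearSeries.ofScalars]

variable {R ι : Type*} [NormedCommRing R]

theorem summable_norm_prod_pi {n : ℕ} {f : Fin n → ι → R}
    (hf : ∀ i, Summable fun k ↦ ‖f i k‖) :
    Summable fun m : Fin n → ι ↦ ‖∏ i, f i (m i)‖ := by
  induction n with
  | zero => exact (hasSum_fintype _).summable
  | succ n ih =>
    rw [← (Fin.consEquiv fun _ ↦ ι).summable_iff]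
    refine ((hf 0).mul_norm (ih fun i ↦ hf i.succ)).congr fun p ↦ ?_
    simp [Fin.prod_univ_succ, Fin.consEquiv]

theorem hasSum_prod_pi [CompleteSpace R] {n : ℕ} {f : Fin n → ι → R} {s : Fin n → R}
    (hf : ∀ i, Summable fun k ↦ ‖f i k‖) (hs : ∀ i, HasSum (f i) (s i)) :
    HasSum (fun m : Fin n → ι ↦ ∏ i, f i (m i)) (∏ i, s i) := by
  induction n with
  | zero => simp
  | succ n ih =>
    have htail := ih (f := fun i ↦ f i.succ) (fun i ↦ hf i.succ) fun i ↦ hs i.succ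
    have hsummable := summable_mul_of_summable_norm (hf 0)
      (summable_norm_prod_pi (f := fun i : Fin n ↦ f i.succ) fun i ↦ hf i.succ)
    rw [← (Fin.consEquiv fun _ ↦ ι).hasSum_iff, Fin.prod_univ_succ]
    refine ((hs 0).mul htail hsummable).congr_fun fun p ↦ ?_
    simp [Fin.prod_univ_succ, Fin.consEquiv]

end PowerSeries

section EulerIntegral

/-- The weight `t ^ (α - 1) * (1 - t) ^ (γ - α - 1)` of the Euler integral of `F_D`. -/
noncomputable def eulerWeight (α γ : ℂ) (t : ℝ) : ℂ :=
  (t : ℂ) ^ (α - 1) * (1 - (t : ℂ)) ^ (γ - α - 1)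

/-- The product `∏ (1 - x i) ^ (-β i)` of principal branches; at `t • x` it is the integrand of
the Euler integral of `F_D` with respect to `eulerWeight`. -/
noncomputable def lauricellaKernel {n : ℕ} (β : Fin n → ℂ) (x : Fin n → ℂ) : ℂ :=
  ∏ i, (1 - x i) ^ (-β i)

/-- The Euler integral of `F_D`, not divided by the beta value `B(α, γ - α)`. -/
noncomputable def lauricellaIntegral {n : ℕ} (α : ℂ) (β : Fin n → ℂ) (γ : ℂ) (x : Fin n → ℂ) : ℂ :=
  ∫ t in Ioo (0 : ℝ) 1, eulerWeight α γ t * lauricellaKernel β ((t : ℂ) • x)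

variable {n : ℕ} {α γ : ℂ} (β : Fin n → ℂ) {x : Fin n → ℂ}

theorem integrableOn_eulerWeight (hα : 0 < α.re) (hγ : 0 < (γ - α).re) :
    IntegrableOn (eulerWeight α γ) (Ioo 0 1) :=
  (intervalIntegrable_iff_integrableOn_Ioo_of_le zero_le_one).1
    (Complex.betaIntegral_convergent hα hγ)

theorem integrableOn_eulerWeight_mul (hα : 0 < α.re) (hγ : 0 < (γ - α).re) {g : ℝ → ℂ}
    (hg : ContinuousOn g (Icc 0 1)) :
    IntegrableOn (fun t : ℝ ↦ eulerWeight α γ t * g t) (Ioo 0 1) := by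
  rw [← integrableOn_Icc_iff_integrableOn_Ioo]
  exact ((integrableOn_Icc_iff_integrableOn_Ioo).2
    (integrableOn_eulerWeight hα hγ)).mul_continuousOn hg isCompact_Icc

theorem betaIntegral_ne_zero {u v : ℂ} (hu : 0 < u.re) (hv : 0 < v.re) :
    Complex.betaIntegral u v ≠ 0 := by
  rw [Complex.betaIntegral_eq_Gamma_mul_div _ _ hu hv]
  have huv : 0 < (u + v).re := by rw [Complex.add_re]; exact add_pos hu hv
  exact div_ne_zero (mul_ne_zero (Complex.Gamma_ne_zero_of_re_pos hu)
    (Complex.Gamma_ne_zero_of_re_pos hv)) (Complex.Gamma_ne_zero_of_re_pos huv)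

theorem pochhammerSymbol_eq_Gamma_div {z : ℂ} (hz : 0 < z.re) (m : ℕ) :
    pochhammerSymbol z m = Complex.Gamma (z + m) / Complex.Gamma z := by
  refine (Complex.Gamma_add_nat_div_Gamma_eq _ fun k hk ↦ ?_).symm
  rw [hk, Complex.neg_re, Complex.natCast_re] at hz
  linarith [(Nat.cast_nonneg k : (0 : ℝ) ≤ k)]

theorem betaIntegral_add_nat {u v : ℂ} (hu : 0 < u.re) (hv : 0 < v.re) (m : ℕ) :
    Complex.betaIntegral (u + m) v =
      Complex.betaIntegral u v * (pochhammerSymbol u m / pochhammerSymbol (u + v) m) := by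
  have hadd {z : ℂ} (hz : 0 < z.re) : 0 < (z + m).re := by
    rw [Complex.add_re, Complex.natCast_re]; positivity
  have huv : 0 < (u + v).re := by rw [Complex.add_re]; positivity
  rw [Complex.betaIntegral_eq_Gamma_mul_div _ _ (hadd hu) hv,
    Complex.betaIntegral_eq_Gamma_mul_div _ _ hu hv, pochhammerSymbol_eq_Gamma_div hu,
    pochhammerSymbol_eq_Gamma_div huv, add_right_comm]
  have := Complex.Gamma_ne_zero_of_re_pos hu
  have := Complex.Gamma_ne_zero_of_re_pos huv
  have := Complex.Gamma_ne_zero_of_re_pos (hadd huv)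
  field_simp

theorem integral_eulerWeight_mul_pow (hα : 0 < α.re) (hγ : 0 < (γ - α).re) (m : ℕ) :
    ∫ t in Ioo (0 : ℝ) 1, eulerWeight α γ t * (t : ℂ) ^ m =
      Complex.betaIntegral α (γ - α) * (pochhammerSymbol α m / pochhammerSymbol γ m) := by
  have hbeta : ∫ t in Ioo (0 : ℝ) 1, eulerWeight α γ t * (t : ℂ) ^ m =
      Complex.betaIntegral (α + m) (γ - α) := by
    rw [Complex.betaIntegral, intervalIntegral.integral_of_le zero_le_one,
      integral_Ioc_eq_integral_Ioo]
    refine setIntegral_congr_fun measurableSet_Ioo fun t ht ↦ ?_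
    have ht0 : (t : ℂ) ≠ 0 := by exact_mod_cast ht.1.ne'
    simp only [eulerWeight]
    rw [add_sub_right_comm, Complex.cpow_add _ _ ht0, Complex.cpow_natCast]
    ring
  rw [hbeta, betaIntegral_add_nat hα hγ, add_sub_cancel]

theorem hasSum_integral_eulerWeight_mul_pow {ι : Type*} [Countable ι] (hα : 0 < α.re)
    (hγ : 0 < (γ - α).re) {c : ι → ℂ} (hc : Summable fun m ↦ ‖c m‖) (d : ι → ℕ) :
    HasSum (fun m ↦ c m * ∫ t in Ioo (0 : ℝ) 1, eulerWeight α γ t * (t : ℂ) ^ d m)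
      (∫ t in Ioo (0 : ℝ) 1, ∑' m, c m * (eulerWeight α γ t * (t : ℂ) ^ d m)) := by
  have hint : ∀ k : ℕ, IntegrableOn (fun t : ℝ ↦ eulerWeight α γ t * (t : ℂ) ^ k) (Ioo 0 1) :=
    fun k ↦ integrableOn_eulerWeight_mul hα hγ (by fun_prop)
  have hnorm : ∀ k : ℕ, ∫ t in Ioo (0 : ℝ) 1, ‖eulerWeight α γ t * (t : ℂ) ^ k‖ ≤
      ∫ t in Ioo (0 : ℝ) 1, ‖eulerWeight α γ t‖ := fun k ↦ by
    refine setIntegral_mono_on (hint k).norm (integrableOn_eulerWeight hα hγ).norm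
      measurableSet_Ioo fun t ht ↦ ?_
    rw [norm_mul, norm_pow, Complex.norm_of_nonneg ht.1.le]
    exact mul_le_of_le_one_right (norm_nonneg _) (pow_le_one₀ ht.1.le ht.2.le)
  simp only [← integral_const_mul]
  refine hasSum_integral_of_summable_integral_norm (fun m ↦ (hint (d m)).const_mul (c m)) ?_
  refine Summable.of_nonneg_of_le (fun m ↦ integral_nonneg fun _ ↦ norm_nonneg _) (fun m ↦ ?_)
    (hc.mul_right (∫ t in Ioo (0 : ℝ) 1, ‖eulerWeight α γ t‖))
  simp only [norm_mul (c m), integral_const_mul]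
  exact mul_le_mul_of_nonneg_left (hnorm _) (norm_nonneg _)

theorem summable_norm_lauricellaKernel_series (hx : ∀ i, ‖x i‖ < 1) :
    Summable fun m : Fin n → ℕ ↦
      ‖∏ i, (pochhammerSymbol (β i) (m i) / ((m i).factorial : ℂ) * x i ^ m i)‖ :=
  summable_norm_prod_pi (f := fun i k ↦ pochhammerSymbol (β i) k / (k.factorial : ℂ) * x i ^ k)
    fun i ↦ summable_norm_pochhammerSymbol_mul_pow (β i) (hx i)

theorem hasSum_lauricellaKernel (hx : ∀ i, ‖x i‖ < 1) :
    HasSum (fun m : Fin n → ℕ ↦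
      ∏ i, (pochhammerSymbol (β i) (m i) / ((m i).factorial : ℂ) * x i ^ m i))
      (lauricellaKernel β x) :=
  hasSum_prod_pi (f := fun i k ↦ pochhammerSymbol (β i) k / (k.factorial : ℂ) * x i ^ k)
    (fun i ↦ summable_norm_pochhammerSymbol_mul_pow (β i) (hx i))
    fun i ↦ hasSum_pochhammerSymbol_mul_pow (β i) (hx i)

theorem lauricellaIntegral_eq_series (hα : 0 < α.re) (hγ : 0 < (γ - α).re)
    (hx : ∀ i, ‖x i‖ < 1) :
    lauricellaIntegral α β γ x =
      Complex.betaIntegral α (γ - α) * lauricellaSeries α β γ x := by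
  set c : (Fin n → ℕ) → ℂ := fun m ↦
    ∏ i, (pochhammerSymbol (β i) (m i) / ((m i).factorial : ℂ) * x i ^ m i) with hc
  have hkernel : ∀ t ∈ Ioo (0 : ℝ) 1, eulerWeight α γ t * lauricellaKernel β ((t : ℂ) • x) =
      ∑' m, c m * (eulerWeight α γ t * (t : ℂ) ^ ∑ i, m i) := fun t ht ↦ by
    have htx : ∀ i, ‖((t : ℂ) • x) i‖ < 1 := fun i ↦ by
      rw [Pi.smul_apply, norm_smul, Complex.norm_of_nonneg ht.1.le]
      exact mul_lt_one_of_nonneg_of_lt_one_left ht.1.le ht.2 (hx i).le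
    rw [← (hasSum_lauricellaKernel β htx).tsum_eq, ← tsum_mul_left]
    refine tsum_congr fun m ↦ ?_
    simp only [hc, Pi.smul_apply, smul_eq_mul, mul_pow, ← Finset.prod_pow_eq_pow_sum,
      Finset.prod_mul_distrib]
    ring
  rw [lauricellaIntegral, setIntegral_congr_fun measurableSet_Ioo hkernel,
    ← (hasSum_integral_eulerWeight_mul_pow hα hγ
      (summable_norm_lauricellaKernel_series β hx) fun m ↦ ∑ i, m i).tsum_eq,
    lauricellaSeries, ← tsum_mul_left]
  refine tsum_congr fun m ↦ ?_
  rw [integral_eulerWeight_mul_pow hα hγ, lauricellaTerm]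
  simp only [Finset.prod_mul_distrib, Finset.prod_div_distrib]
  ring

theorem isOpen_lauricellaDomain (n : ℕ) : IsOpen (lauricellaDomain n) := by
  simp only [lauricellaDomain, Set.ofPred_forall]
  exact isOpen_iInter_of_finite fun i ↦ Complex.isOpen_slitPlane.preimage (by fun_prop)

theorem smul_mem_lauricellaDomain (hx : x ∈ lauricellaDomain n) {t : ℝ}
    (ht : t ∈ Icc (0 : ℝ) 1) : (t : ℂ) • x ∈ lauricellaDomain n := fun i ↦ by
  have h := Complex.starConvex_one_slitPlane (hx i) (sub_nonneg.2 ht.2) ht.1 (sub_add_cancel 1 t)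
  convert! h using 1
  simp only [Pi.smul_apply, smul_eq_mul, Complex.real_smul, Complex.ofReal_sub,
    Complex.ofReal_one]
  ring

theorem analyticAt_lauricellaKernel (hx : x ∈ lauricellaDomain n) :
    AnalyticAt ℂ (lauricellaKernel β) x :=
  Finset.analyticAt_fun_prod _ fun i _ ↦ (analyticAt_const.sub
    ((ContinuousLinearMap.proj (R := ℂ) (φ := fun _ : Fin n ↦ ℂ) i).analyticAt x)).cpow
      analyticAt_const (hx i)

theorem continuousOn_lauricellaKernel_smul (hx : x ∈ lauricellaDomain n) :
    ContinuousOn (fun t : ℝ ↦ lauricellaKernel β ((t : ℂ) • x)) (Icc 0 1) := fun t ht ↦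
  ((analyticAt_lauricellaKernel β (smul_mem_lauricellaDomain hx ht)).continuousAt.comp
    (f := fun t : ℝ ↦ (t : ℂ) • x) (by fun_prop)).continuousWithinAt

theorem integrableOn_lauricellaIntegrand (hα : 0 < α.re) (hγ : 0 < (γ - α).re)
    (hx : x ∈ lauricellaDomain n) :
    IntegrableOn (fun t : ℝ ↦ eulerWeight α γ t * lauricellaKernel β ((t : ℂ) • x)) (Ioo 0 1) :=
  integrableOn_eulerWeight_mul hα hγ (continuousOn_lauricellaKernel_smul β hx)

theorem continuousOn_fderiv_lauricellaKernel :
    ContinuousOn (fderiv ℂ (lauricellaKernel β)) (lauricellaDomain n) := fun _ hx ↦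
  (analyticAt_lauricellaKernel β hx).fderiv.continuousAt.continuousWithinAt

theorem hasFDerivAt_lauricellaIntegrand (w : ℂ) {t : ℝ} (ht : (t : ℂ) • x ∈ lauricellaDomain n) :
    HasFDerivAt (fun y : Fin n → ℂ ↦ w * lauricellaKernel β ((t : ℂ) • y))
      ((w * t) • fderiv ℂ (lauricellaKernel β) ((t : ℂ) • x)) x := by
  have hkernel := (analyticAt_lauricellaKernel β ht).differentiableAt.hasFDerivAt
  convert! (hkernel.comp x ((hasFDerivAt_id x).const_smul (t : ℂ))).const_mul w using 1
  ext v
  simp [mul_assoc]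

theorem exists_norm_fderiv_lauricellaKernel_smul_le {K : Set (Fin n → ℂ)} (hK : IsCompact K)
    (hKd : K ⊆ lauricellaDomain n) :
    ∃ M, ∀ t ∈ Icc (0 : ℝ) 1, ∀ y ∈ K, ‖fderiv ℂ (lauricellaKernel β) ((t : ℂ) • y)‖ ≤ M := by
  have hcone : IsCompact ((fun p : ℝ × (Fin n → ℂ) ↦ (p.1 : ℂ) • p.2) '' (Icc (0 : ℝ) 1 ×ˢ K)) :=
    (isCompact_Icc.prod hK).image (by fun_prop)
  obtain ⟨M, hM⟩ := hcone.exists_bound_of_continuousOn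
    ((continuousOn_fderiv_lauricellaKernel β).mono (by
      rintro _ ⟨⟨t, y⟩, ⟨ht, hy⟩, rfl⟩
      exact smul_mem_lauricellaDomain (hKd hy) ht))
  exact ⟨M, fun t ht y hy ↦ hM _ ⟨(t, y), ⟨ht, hy⟩, rfl⟩⟩

theorem differentiableOn_lauricellaIntegral (hα : 0 < α.re) (hγ : 0 < (γ - α).re) :
    DifferentiableOn ℂ (lauricellaIntegral α β γ) (lauricellaDomain n) := by
  intro x₀ hx₀
  have hnhds := (isOpen_lauricellaDomain n).mem_nhds hx₀
  obtain ⟨ε, hε, hball⟩ := Metric.nhds_basis_closedBall.mem_iff.1 hnhds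
  obtain ⟨M, hM⟩ := exists_norm_fderiv_lauricellaKernel_smul_le β (isCompact_closedBall x₀ ε) hball
  have hw := integrableOn_eulerWeight hα hγ
  have hderiv_meas : AEStronglyMeasurable (fun t : ℝ ↦
      (eulerWeight α γ t * t) • fderiv ℂ (lauricellaKernel β) ((t : ℂ) • x₀))
      (volume.restrict (Ioo 0 1)) := by
    refine (hw.aestronglyMeasurable.mul
      Complex.continuous_ofReal.aestronglyMeasurable).smul ?_
    refine ContinuousOn.aestronglyMeasurable ?_ measurableSet_Ioo
    exact (continuousOn_fderiv_lauricellaKernel β).comp (by fun_prop) fun t ht ↦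
      smul_mem_lauricellaDomain hx₀ (Ioo_subset_Icc_self ht)
  refine (hasFDerivAt_integral_of_dominated_of_fderiv_le (𝕜 := ℂ)
    (F := fun y t ↦ eulerWeight α γ t * lauricellaKernel β ((t : ℂ) • y))
    (F' := fun y t ↦ (eulerWeight α γ t * t) • fderiv ℂ (lauricellaKernel β) ((t : ℂ) • y))
    (bound := fun t ↦ ‖eulerWeight α γ t‖ * M) (Metric.closedBall_mem_nhds x₀ hε) ?_
    (integrableOn_lauricellaIntegrand β hα hγ hx₀) hderiv_meas ?_
    (hw.norm.mul_const M) ?_).differentiableAt.differentiableWithinAt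
  · filter_upwards [hnhds] with y hy
    exact (integrableOn_lauricellaIntegrand β hα hγ hy).aestronglyMeasurable
  · filter_upwards [ae_restrict_mem measurableSet_Ioo] with t ht y hy
    rw [norm_smul, norm_mul, Complex.norm_of_nonneg ht.1.le, mul_assoc]
    exact mul_le_mul_of_nonneg_left ((mul_le_of_le_one_left (norm_nonneg _) ht.2.le).trans
      (hM t (Ioo_subset_Icc_self ht) y hy)) (norm_nonneg _)
  · filter_upwards [ae_restrict_mem measurableSet_Ioo] with t ht y hy
    exact hasFDerivAt_lauricellaIntegrand β _
      (smul_mem_lauricellaDomain (hball hy) (Ioo_subset_Icc_self ht))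

theorem IsLauricellaContinuation.eqOn {β : Fin n → ℂ} {F G : (Fin n → ℂ) → ℂ}
    (hF : IsLauricellaContinuation α β γ F) (hG : IsLauricellaContinuation α β γ G) :
    EqOn F G (lauricellaDomain n) := by
  intro x hx
  -- The two functions are compared on the slice through `0` and `x`.
  set U : Set ℂ := {z | z • x ∈ lauricellaDomain n} with hU
  have hUo : IsOpen U := (isOpen_lauricellaDomain n).preimage (by fun_prop)
  have h0 : (0 : ℂ) ∈ U := by simp [hU, lauricellaDomain]
  have h1 : (1 : ℂ) ∈ U := by simpa [hU] using hx
  have hstar : StarConvex ℝ 0 U := starConvex_zero_iff.2 fun z hz t ht0 ht1 ↦ by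
    have := smul_mem_lauricellaDomain hz ⟨ht0, ht1⟩
    rwa [smul_smul] at this
  have hconn : IsPreconnected U := (hstar.isPathConnected h0).isConnected.isPreconnected
  have han : ∀ {H : (Fin n → ℂ) → ℂ}, DifferentiableOn ℂ H (lauricellaDomain n) →
      AnalyticOnNhd ℂ (fun z : ℂ ↦ H (z • x)) U := fun hH ↦
    (hH.comp (s := U) (f := fun z : ℂ ↦ z • x) (by fun_prop) fun z hz ↦ hz).analyticOnNhd hUo
  have hev : (fun z : ℂ ↦ F (z • x)) =ᶠ[𝓝 0] fun z ↦ G (z • x) := by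
    have hsmall : ∀ᶠ z : ℂ in 𝓝 0, ‖z • x‖ < 1 :=
      ContinuousAt.eventually_lt (by fun_prop) continuousAt_const (by simp)
    filter_upwards [hsmall] with z hz
    have hz' := fun i ↦ (norm_le_pi_norm (z • x) i).trans_lt hz
    rw [hF.2 _ hz', hG.2 _ hz']
  simpa using (han hF.1).eqOn_of_preconnected_of_eventuallyEq (han hG.1) hconn h0 hev h1

theorem betaIntegral_mul_lauricellaFD (hα : 0 < α.re) (hγ : 0 < (γ - α).re)
    (hx : x ∈ lauricellaDomain n) :
    Complex.betaIntegral α (γ - α) * lauricellaFD α β γ x = lauricellaIntegral α β γ x := by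
  have hB := betaIntegral_ne_zero hα hγ
  have hcont : IsLauricellaContinuation α β γ
      fun y ↦ (Complex.betaIntegral α (γ - α))⁻¹ * lauricellaIntegral α β γ y :=
    ⟨(differentiableOn_lauricellaIntegral β hα hγ).const_mul _, fun y hy ↦ by
      simp only [lauricellaIntegral_eq_series β hα hγ hy, inv_mul_cancel_left₀ hB]⟩
  have h : x ∈ lauricellaDomain n ∧ ∃ F, IsLauricellaContinuation α β γ F := ⟨hx, _, hcont⟩
  rw [lauricellaFD, dif_pos h, h.2.choose_spec.eqOn hcont hx, mul_inv_cancel_left₀ hB]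

end EulerIntegral

section Pfaff

theorem arg_nonpos_of_im_nonpos {z : ℂ} (hz : z ∈ Complex.slitPlane) (him : z.im ≤ 0) :
    z.arg ≤ 0 := by
  rcases him.lt_or_eq with him | him
  · exact (Complex.arg_neg_iff.2 him).le
  · refine (Complex.arg_eq_zero_iff.2 ⟨?_, him⟩).le
    exact ((Complex.mem_slitPlane_iff.1 hz).resolve_right (not_not.2 him)).le

theorem mul_cpow_of_im_mul_im_nonpos {z w : ℂ} (hz : z ∈ Complex.slitPlane)
    (hw : w ∈ Complex.slitPlane) (him : z.im * w.im ≤ 0) (p : ℂ) :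
    (z * w) ^ p = z ^ p * w ^ p := by
  have hz0 := Complex.slitPlane_ne_zero hz
  have hw0 := Complex.slitPlane_ne_zero hw
  have harg : z.arg + w.arg ∈ Ioc (-Real.pi) Real.pi := by
    rcases mul_nonpos_iff.1 him with ⟨hz', hw'⟩ | ⟨hz', hw'⟩
    · have := Complex.arg_nonneg_iff.2 hz'
      have := arg_nonpos_of_im_nonpos hw hw'
      constructor <;> linarith [z.arg_le_pi, w.neg_pi_lt_arg]
    · have := Complex.arg_nonneg_iff.2 hw'
      have := arg_nonpos_of_im_nonpos hz hz'
      constructor <;> linarith [w.arg_le_pi, z.neg_pi_lt_arg]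
  rw [Complex.cpow_def_of_ne_zero (mul_ne_zero hz0 hw0), Complex.cpow_def_of_ne_zero hz0,
    Complex.cpow_def_of_ne_zero hw0, (Complex.log_mul_eq_add_log_iff hz0 hw0).2 harg, add_mul,
    Complex.exp_add]

variable {n : ℕ} {α γ : ℂ} (β : Fin n → ℂ) {x : Fin n → ℂ}

theorem one_sub_div_sub_one {K : Type*} [Field K] {z : K} (hz : 1 - z ≠ 0) :
    1 - z / (z - 1) = (1 - z)⁻¹ := by
  rw [← neg_sub 1 z]
  field_simp
  ring

theorem div_sub_one_mem_lauricellaDomain (hx : x ∈ lauricellaDomain n) :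
    (fun i ↦ x i / (x i - 1)) ∈ lauricellaDomain n := fun i ↦ by
  have hne := Complex.slitPlane_ne_zero (hx i)
  have harg := Complex.slitPlane_arg_ne_pi (hx i)
  rw [one_sub_div_sub_one hne, Complex.mem_slitPlane_iff_arg, Complex.arg_inv, if_neg harg]
  exact ⟨fun h ↦ (Complex.neg_pi_lt_arg _).ne' (neg_eq_iff_eq_neg.1 h), inv_ne_zero hne⟩

theorem one_sub_mul_cpow (p : ℂ) (hx : x ∈ lauricellaDomain n) {t : ℝ} (ht : t ∈ Icc (0 : ℝ) 1)
    (i : Fin n) :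
    (1 - (1 - t) * x i) ^ p = (1 - x i) ^ p * (1 - t * (x i / (x i - 1))) ^ p := by
  have hne := Complex.slitPlane_ne_zero (hx i)
  have hfactor : 1 - (1 - t) * x i = (1 - x i) * (1 - t * (x i / (x i - 1))) := by
    linear_combination (-(t * (1 - x i))) * one_sub_div_sub_one hne - t * mul_inv_cancel₀ hne
  have him : (1 - t * (x i / (x i - 1))).im = t * -(1 - x i).im / Complex.normSq (1 - x i) := by
    rw [← sub_sub_cancel 1 (x i / (x i - 1)), one_sub_div_sub_one hne]
    simp [mul_div_assoc]
  rw [hfactor]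
  refine mul_cpow_of_im_mul_im_nonpos (hx i)
    (smul_mem_lauricellaDomain (div_sub_one_mem_lauricellaDomain hx) ht i) ?_ p
  simp only [Pi.smul_apply, smul_eq_mul, him]
  have := div_nonneg (mul_nonneg ht.1 (sq_nonneg (1 - x i).im)) (Complex.normSq_nonneg (1 - x i))
  linear_combination this

theorem lauricellaKernel_one_sub_smul (hx : x ∈ lauricellaDomain n) {t : ℝ}
    (ht : t ∈ Icc (0 : ℝ) 1) :
    lauricellaKernel β (((1 - t : ℝ) : ℂ) • x) =
      lauricellaKernel β x * lauricellaKernel β ((t : ℂ) • fun i ↦ x i / (x i - 1)) := by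
  simp only [lauricellaKernel, ← Finset.prod_mul_distrib, Pi.smul_apply, smul_eq_mul,
    Complex.ofReal_sub, Complex.ofReal_one]
  exact Finset.prod_congr rfl fun i _ ↦ one_sub_mul_cpow _ hx ht i

theorem eulerWeight_one_sub (α γ : ℂ) (t : ℝ) :
    eulerWeight α γ (1 - t) = eulerWeight (γ - α) γ t := by
  simp only [eulerWeight, Complex.ofReal_sub, Complex.ofReal_one, sub_sub_cancel]
  exact mul_comm _ _

theorem setIntegral_Ioo_zero_one_comp_one_sub {E : Type*} [NormedAddCommGroup E]
    [NormedSpace ℝ E] (f : ℝ → E) :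
    ∫ t in Ioo (0 : ℝ) 1, f (1 - t) = ∫ t in Ioo (0 : ℝ) 1, f t := by
  simpa only [intervalIntegral.integral_of_le zero_le_one, integral_Ioc_eq_integral_Ioo,
    sub_self, sub_zero] using
    intervalIntegral.integral_comp_sub_left (a := (0 : ℝ)) (b := 1) f 1

theorem lauricellaIntegral_pfaff (hx : x ∈ lauricellaDomain n) :
    lauricellaIntegral α β γ x =
      lauricellaKernel β x * lauricellaIntegral (γ - α) β γ fun i ↦ x i / (x i - 1) := by
  rw [lauricellaIntegral, ← setIntegral_Ioo_zero_one_comp_one_sub, lauricellaIntegral,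
    ← integral_const_mul]
  refine setIntegral_congr_fun measurableSet_Ioo fun t ht ↦ ?_
  simp only [eulerWeight_one_sub, lauricellaKernel_one_sub_smul β hx (Ioo_subset_Icc_self ht)]
  ring

theorem lauricellaFD_pfaff (hα : 0 < α.re) (hγ : 0 < (γ - α).re)
    (hx : x ∈ lauricellaDomain n) :
    lauricellaFD α β γ x =
      lauricellaKernel β x * lauricellaFD (γ - α) β γ fun i ↦ x i / (x i - 1) := by
  have hα' : 0 < (γ - (γ - α)).re := by rwa [sub_sub_cancel]
  refine mul_left_cancel₀ (betaIntegral_ne_zero hα hγ) ?_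
  rw [betaIntegral_mul_lauricellaFD β hα hγ hx, lauricellaIntegral_pfaff β hx,
    ← betaIntegral_mul_lauricellaFD β hγ hα' (div_sub_one_mem_lauricellaDomain hx),
    sub_sub_cancel, Complex.betaIntegral_symm]
  ring

end Pfaff

section ChangeOfVariables

variable {E : Type*} [NormedAddCommGroup E] [NormedSpace ℝ E]

theorem setIntegral_eq_of_bijOn {φ φ' : ℝ → ℝ} {f g : ℝ → E} {s t : Set ℝ} (hs : MeasurableSet s)
    (hφ : BijOn φ s t) (hderiv : ∀ x ∈ s, HasDerivAt φ (φ' x) x)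
    (hfg : ∀ x ∈ s, |φ' x| • f (φ x) = g x) :
    ∫ y in t, f y = ∫ x in s, g x := by
  rw [← hφ.image_eq, integral_image_eq_integral_abs_deriv_smul hs
    (fun x hx ↦ (hderiv x hx).hasDerivWithinAt) hφ.injOn]
  exact setIntegral_congr_fun hs hfg

theorem integrableOn_of_bijOn {φ φ' : ℝ → ℝ} {f g : ℝ → E} {s t : Set ℝ} (hs : MeasurableSet s)
    (hφ : BijOn φ s t) (hderiv : ∀ x ∈ s, HasDerivAt φ (φ' x) x)
    (hfg : ∀ x ∈ s, |φ' x| • f (φ x) = g x) (hf : IntegrableOn f t) : IntegrableOn g s := by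
  rw [← hφ.image_eq, integrableOn_image_iff_integrableOn_abs_deriv_smul hs
    (fun x hx ↦ (hderiv x hx).hasDerivWithinAt) hφ.injOn] at hf
  exact hf.congr_fun hfg hs

theorem setIntegral_Ioo_neg_one_one_of_even {f : ℝ → ℝ} (hf : ∀ y, f |y| = f y) :
    ∫ y in Ioo (-1 : ℝ) 1, f y = 2 * ∫ y in Ioo (0 : ℝ) 1, f y := by
  have h := integral_comp_abs (f := (Iio (1 : ℝ)).indicator f)
  rw [setIntegral_indicator measurableSet_Iio, Ioi_inter_Iio] at h
  rw [← h, ← integral_indicator measurableSet_Ioo]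
  congr 1
  ext y
  simp only [indicator, mem_Ioo, mem_Iio, abs_lt, hf]

theorem bijOn_sub_div {c : ℝ} (hc : 0 < c) : BijOn (fun w ↦ w - c / w) (Ioi 0) univ := by
  refine ⟨mapsTo_univ _ _, fun x hx y hy hxy ↦ ?_, fun v _ ↦ ?_⟩
  · have hx : 0 < x := hx
    have hy : 0 < y := hy
    have hfactor : (x - y) * (x * y + c) = 0 := by
      simp only at hxy
      field_simp at hxy
      linear_combination hxy
    exact sub_eq_zero.1 ((mul_eq_zero.1 hfactor).resolve_right (by positivity))
  · have hsq : √(v ^ 2 + 4 * c) ^ 2 = v ^ 2 + 4 * c := Real.sq_sqrt (by positivity)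
    have habs : |v| < √(v ^ 2 + 4 * c) := by
      rw [Real.lt_sqrt (abs_nonneg v), sq_abs]
      linarith
    have hpos : 0 < (v + √(v ^ 2 + 4 * c)) / 2 := by linarith [neg_abs_le v]
    refine ⟨_, hpos, ?_⟩
    set y := (v + √(v ^ 2 + 4 * c)) / 2 with hy
    have hyq : y ^ 2 = v * y + c := by
      rw [hy]
      linear_combination hsq / 4
    change y - c / y = v
    field_simp
    linarith

theorem bijOn_div_Ioi {c : ℝ} (hc : 0 < c) : BijOn (fun w ↦ c / w) (Ioi 0) (Ioi 0) := by
  have hinv : LeftInvOn (fun w ↦ c / w) (fun w ↦ c / w) (Ioi 0) := fun w _ ↦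
    div_div_cancel₀ hc.ne'
  have hmaps : MapsTo (fun w ↦ c / w) (Ioi 0) (Ioi 0) := fun w hw ↦ div_pos hc hw
  exact InvOn.bijOn ⟨hinv, hinv⟩ hmaps hmaps

theorem hasDerivAt_const_div (c : ℝ) {w : ℝ} (hw : w ≠ 0) :
    HasDerivAt (fun w ↦ c / w) (-(c / w ^ 2)) w := by
  simpa [div_eq_mul_inv] using (hasDerivAt_inv hw).const_mul c

theorem hasDerivAt_sub_const_div (c : ℝ) {w : ℝ} (hw : w ≠ 0) :
    HasDerivAt (fun w ↦ w - c / w) (1 + c / w ^ 2) w :=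
  ((hasDerivAt_id' w).fun_sub (hasDerivAt_const_div c hw)).congr_deriv (sub_neg_eq_add _ _)

theorem integrableOn_comp_sub_div {f : ℝ → ℝ} (hf : Integrable f) {c : ℝ} (hc : 0 < c) :
    IntegrableOn (fun w ↦ f (w - c / w)) (Ioi 0) := by
  have hsum : IntegrableOn (fun w ↦ |1 + c / w ^ 2| • f (w - c / w)) (Ioi 0) :=
    integrableOn_of_bijOn measurableSet_Ioi (bijOn_sub_div hc)
      (fun w hw ↦ hasDerivAt_sub_const_div c (ne_of_gt hw)) (fun _ _ ↦ rfl) hf.integrableOn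
  have hbound : ∀ w : ℝ, ‖w ^ 2 / (w ^ 2 + c)‖ ≤ 1 := fun w ↦ by
    rw [Real.norm_of_nonneg (by positivity), div_le_one (by positivity)]
    linarith
  have hmeas : Measurable fun w : ℝ ↦ w ^ 2 / (w ^ 2 + c) := by fun_prop
  refine IntegrableOn.congr_fun (hsum.bdd_mul hmeas.aestronglyMeasurable (.of_forall hbound))
    (fun w hw ↦ ?_) measurableSet_Ioi
  have hw : 0 < w := hw
  simp only [smul_eq_mul]
  rw [abs_of_pos (by positivity)]
  field_simp

/-- The Cauchy–Schlömilch transformation. -/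
theorem setIntegral_Ioi_comp_sub_div {f : ℝ → ℝ} (hf : Integrable f) (heven : ∀ v, f |v| = f v)
    {c : ℝ} (hc : 0 < c) :
    ∫ w in Ioi 0, f (w - c / w) = ∫ v in Ioi 0, f v := by
  have hreflect : ∀ w ∈ Ioi (0 : ℝ), |-(c / w ^ 2)| • f (c / w - c / (c / w)) =
      c / w ^ 2 * f (w - c / w) := fun w hw ↦ by
    have hw : 0 < w := hw
    rw [div_div_cancel₀ hc.ne', abs_neg, abs_of_pos (by positivity), smul_eq_mul,
      ← heven, abs_sub_comm, heven]
  have hint : IntegrableOn (fun w ↦ f (w - c / w)) (Ioi 0) := integrableOn_comp_sub_div hf hc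
  have hint' : IntegrableOn (fun w ↦ c / w ^ 2 * f (w - c / w)) (Ioi 0) :=
    integrableOn_of_bijOn measurableSet_Ioi (bijOn_div_Ioi hc)
      (fun w hw ↦ hasDerivAt_const_div c (ne_of_gt hw)) hreflect hint
  have hreflected : ∫ w in Ioi 0, f (w - c / w) = ∫ w in Ioi 0, c / w ^ 2 * f (w - c / w) :=
    setIntegral_eq_of_bijOn measurableSet_Ioi (bijOn_div_Ioi hc)
      (fun w hw ↦ hasDerivAt_const_div c (ne_of_gt hw)) hreflect
  have hline : ∫ v, f v = ∫ w in Ioi 0, (f (w - c / w) + c / w ^ 2 * f (w - c / w)) := by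
    rw [← setIntegral_univ]
    refine setIntegral_eq_of_bijOn measurableSet_Ioi (bijOn_sub_div hc)
      (fun w hw ↦ hasDerivAt_sub_const_div c (ne_of_gt hw)) fun w hw ↦ ?_
    have hw : 0 < w := hw
    rw [abs_of_pos (by positivity), smul_eq_mul, add_mul, one_mul]
  have hhalf : ∫ v, f v = 2 * ∫ v in Ioi 0, f v := by
    rw [← integral_comp_abs]
    exact integral_congr_ae (.of_forall fun v ↦ (heven v).symm)
  rw [integral_add hint hint', ← hreflected, hhalf] at hline
  linarith

end ChangeOfVariables

section EllipticIntegral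

theorem ellipticK_neg (k : ℝ) : ellipticK (-k) = ellipticK k := by
  simp only [ellipticK, neg_sq]

theorem ellipticK_eq_setIntegral (k : ℝ) :
    ellipticK k = ∫ u in Ioo (0 : ℝ) 1, 1 / √((1 - u ^ 2) * (1 - k ^ 2 * u ^ 2)) := by
  rw [ellipticK, intervalIntegral.integral_of_le zero_le_one, integral_Ioc_eq_integral_Ioo]

theorem bijOn_sqrt_Ioo_zero_one : BijOn (√·) (Ioo 0 1) (Ioo 0 1) :=
  InvOn.bijOn (f' := (· ^ 2))
    ⟨fun _ hx ↦ Real.sq_sqrt hx.1.le, fun _ hy ↦ Real.sqrt_sq hy.1.le⟩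
    (fun _ hx ↦ ⟨Real.sqrt_pos.2 hx.1, (Real.sqrt_lt' one_pos).2 (by simpa using hx.2)⟩)
    fun _ hy ↦ ⟨pow_pos hy.1 2, pow_lt_one₀ hy.1.le hy.2 two_ne_zero⟩

theorem ellipticK_eq_setIntegral_cubic (k : ℝ) :
    ellipticK k = ∫ x in Ioo (0 : ℝ) 1, 1 / (2 * √(x * (1 - x) * (1 - k ^ 2 * x))) := by
  rw [ellipticK_eq_setIntegral]
  refine setIntegral_eq_of_bijOn measurableSet_Ioo bijOn_sqrt_Ioo_zero_one
    (fun x hx ↦ Real.hasDerivAt_sqrt hx.1.ne') fun x hx ↦ ?_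
  have hx₀ := hx.1
  rw [Real.sq_sqrt hx₀.le, abs_of_pos (by positivity), mul_assoc x, Real.sqrt_mul hx₀.le,
    smul_eq_mul, div_mul_div_comm, one_mul, mul_assoc]

theorem bijOn_one_sub_sq_Ioo_zero_one : BijOn (fun y : ℝ ↦ 1 - y ^ 2) (Ioo 0 1) (Ioo 0 1) := by
  refine InvOn.bijOn (f' := fun x ↦ √(1 - x)) ⟨fun y hy ↦ ?_, fun x hx ↦ ?_⟩
    (fun y hy ↦ ?_) fun x hx ↦ ?_
  · simp only [sub_sub_cancel, Real.sqrt_sq hy.1.le]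
  · simp only [Real.sq_sqrt (sub_nonneg.2 hx.2.le), sub_sub_cancel]
  · exact ⟨sub_pos.2 (pow_lt_one₀ hy.1.le hy.2 two_ne_zero), sub_lt_self 1 (pow_pos hy.1 2)⟩
  · refine ⟨Real.sqrt_pos.2 (sub_pos.2 hx.2), (Real.sqrt_lt' one_pos).2 ?_⟩
    linarith [hx.1]

theorem ellipticK_eq_setIntegral_complementary (k : ℝ) :
    ellipticK k = ∫ y in Ioo (0 : ℝ) 1, 1 / √((1 - y ^ 2) * (1 - k ^ 2 * (1 - y ^ 2))) := by
  rw [ellipticK_eq_setIntegral_cubic]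
  refine setIntegral_eq_of_bijOn (φ' := fun y ↦ -(2 * y)) measurableSet_Ioo
    bijOn_one_sub_sq_Ioo_zero_one
    (fun y _ ↦ by simpa using (hasDerivAt_pow 2 y).const_sub 1) fun y hy ↦ ?_
  have hy₀ := hy.1
  rw [sub_sub_cancel, abs_neg, abs_of_pos (by positivity), mul_right_comm,
    Real.sqrt_mul' _ (sq_nonneg y), Real.sqrt_sq hy₀.le, smul_eq_mul]
  field_simp

end EllipticIntegral

section GenusTwo

/-- The quintic defining the genus two curve `w² = t (1 - t²) (1 - k² t²)`. -/
def genusTwoQuintic (k t : ℝ) : ℝ := t * (1 - t ^ 2) * (1 - k ^ 2 * t ^ 2)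

/-- The period of the differential of the first kind `tʲ dt / w`, `j = 0, 1`, of the curve
`w² = genusTwoQuintic k t` along the real segment `[0, 1]`. -/
noncomputable def genusTwoPeriod (j : ℕ) (k : ℝ) : ℝ :=
  ∫ t in Ioo (0 : ℝ) 1, t ^ j / √(genusTwoQuintic k t)

/-- The `x`-coordinate of the degree two map from the curve `w² = genusTwoQuintic (s ^ 2) t` onto
the elliptic curve `y² = x (1 - x) (1 - k² x)`, where `k = (1 + s) / √(2 (1 + s²))`. -/
noncomputable def genusTwoMap (s t : ℝ) : ℝ := 2 * (1 + s ^ 2) * t / ((1 + t) * (1 + s ^ 2 * t))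

variable {s t : ℝ}

theorem one_sub_mul_pos (hs : |s| < 1) (ht : t ∈ Ioo (0 : ℝ) 1) : 0 < 1 - s * t := by
  nlinarith [le_abs_self s, ht.1, ht.2, abs_nonneg s]

theorem one_add_mul_pos (hs : |s| < 1) (ht : t ∈ Ioo (0 : ℝ) 1) : 0 < 1 + s * t := by
  simpa using one_sub_mul_pos (s := -s) (by rwa [abs_neg]) ht

theorem genusTwoQuintic_pos {k : ℝ} (hk : |k| < 1) (ht : t ∈ Ioo (0 : ℝ) 1) :
    0 < genusTwoQuintic k t := by
  have ht₀ := ht.1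
  have hsq : 0 < 1 - t ^ 2 := sub_pos.2 (pow_lt_one₀ ht.1.le ht.2 two_ne_zero)
  have hprod := mul_pos (one_sub_mul_pos hk ht) (one_add_mul_pos hk ht)
  rw [genusTwoQuintic, show 1 - k ^ 2 * t ^ 2 = (1 - k * t) * (1 + k * t) by ring]
  positivity

theorem genusTwoQuintic_neg (k t : ℝ) : genusTwoQuintic (-k) t = genusTwoQuintic k t := by
  rw [genusTwoQuintic, genusTwoQuintic, neg_sq]

theorem genusTwoPeriod_neg (j : ℕ) (k : ℝ) : genusTwoPeriod j (-k) = genusTwoPeriod j k := by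
  simp only [genusTwoPeriod, genusTwoQuintic_neg]

theorem one_sub_genusTwoMap (s : ℝ) (ht : 0 ≤ t) :
    1 - genusTwoMap s t = (1 - t) * (1 - s ^ 2 * t) / ((1 + t) * (1 + s ^ 2 * t)) := by
  rw [genusTwoMap, eq_div_iff (by positivity), sub_mul, div_mul_cancel₀ _ (by positivity)]
  ring

theorem one_sub_sq_mul_genusTwoMap (s : ℝ) (ht : 0 ≤ t) :
    1 - ((1 + s) / √(2 * (1 + s ^ 2))) ^ 2 * genusTwoMap s t =
      (1 - s * t) ^ 2 / ((1 + t) * (1 + s ^ 2 * t)) := by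
  rw [genusTwoMap, div_pow, Real.sq_sqrt (by positivity)]
  field_simp
  ring

theorem genusTwoMap_cubic_eq (s : ℝ) (ht : 0 ≤ t) :
    genusTwoMap s t * (1 - genusTwoMap s t) *
        (1 - ((1 + s) / √(2 * (1 + s ^ 2))) ^ 2 * genusTwoMap s t) =
      genusTwoQuintic (s ^ 2) t * (2 * (1 + s ^ 2)) *
        ((1 - s * t) / ((1 + t) * (1 + s ^ 2 * t)) ^ 2) ^ 2 := by
  rw [one_sub_genusTwoMap s ht, one_sub_sq_mul_genusTwoMap s ht, genusTwoMap, genusTwoQuintic]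
  field_simp
  ring

theorem hasDerivAt_genusTwoMap (s : ℝ) (ht : 0 ≤ t) :
    HasDerivAt (genusTwoMap s)
      (2 * (1 + s ^ 2) * ((1 - s * t) * (1 + s * t)) / ((1 + t) * (1 + s ^ 2 * t)) ^ 2) t := by
  have hnum := (hasDerivAt_id' t).const_mul (2 * (1 + s ^ 2))
  have hden := ((hasDerivAt_id' t).const_add 1).fun_mul
    (((hasDerivAt_id' t).const_mul (s ^ 2)).const_add 1)
  refine (hnum.div hden (by positivity)).congr_deriv ?_
  ring

theorem bijOn_genusTwoMap (hs : |s| < 1) : BijOn (genusTwoMap s) (Ioo 0 1) (Ioo 0 1) := by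
  have hcont : ContinuousOn (genusTwoMap s) (Icc 0 1) := fun t ht ↦
    (hasDerivAt_genusTwoMap s ht.1).continuousAt.continuousWithinAt
  have hmono : StrictMonoOn (genusTwoMap s) (Icc 0 1) := by
    refine strictMonoOn_of_deriv_pos (convex_Icc 0 1) hcont fun t ht ↦ ?_
    rw [interior_Icc] at ht
    have ht₀ := ht.1
    have hsub := one_sub_mul_pos hs ht
    have hadd := one_add_mul_pos hs ht
    rw [(hasDerivAt_genusTwoMap s ht₀.le).deriv]
    positivity
  have hzero : genusTwoMap s 0 = 0 := by simp [genusTwoMap]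
  have hone : genusTwoMap s 1 = 1 := by
    have := one_sub_genusTwoMap s zero_le_one
    rw [sub_self, zero_mul, zero_div] at this
    linarith
  have himage := hcont.image_Ioo_of_strictMonoOn zero_le_one hmono
  rw [hzero, hone] at himage
  simpa only [himage] using (hmono.injOn.mono Ioo_subset_Icc_self).bijOn_image

theorem ellipticK_eq_genusTwo (hs : |s| < 1) :
    ellipticK ((1 + s) / √(2 * (1 + s ^ 2))) =
      √((1 + s ^ 2) / 2) *
        ∫ t in Ioo (0 : ℝ) 1, (1 + s * t) / √(genusTwoQuintic (s ^ 2) t) := by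
  rw [ellipticK_eq_setIntegral_cubic, ← integral_const_mul]
  refine setIntegral_eq_of_bijOn measurableSet_Ioo (bijOn_genusTwoMap hs)
    (fun t ht ↦ hasDerivAt_genusTwoMap s ht.1.le) fun t ht ↦ ?_
  have ht₀ := ht.1
  have hsub := one_sub_mul_pos hs ht
  have hadd := one_add_mul_pos hs ht
  have hsq : |s ^ 2| < 1 := by
    rw [abs_pow]
    exact pow_lt_one₀ (abs_nonneg s) hs two_ne_zero
  have hquintic : 0 < √(genusTwoQuintic (s ^ 2) t) := Real.sqrt_pos.2 (genusTwoQuintic_pos hsq ht)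
  have hroot : √(1 + s ^ 2) ^ 2 = 1 + s ^ 2 := Real.sq_sqrt (by positivity)
  rw [genusTwoMap_cubic_eq s ht₀.le, Real.sqrt_mul' _ (sq_nonneg _),
    Real.sqrt_mul' _ (by positivity), Real.sqrt_sq (by positivity), abs_of_pos (by positivity),
    smul_eq_mul, Real.sqrt_div' _ zero_le_two, Real.sqrt_mul zero_le_two]
  field_simp
  exact hroot.symm

end GenusTwo

section QuarticPeriod

variable {r k : ℝ}

theorem bijOn_cayley_sq (hr : 0 < r) :
    BijOn (fun v ↦ (r - v ^ 2) / (r + v ^ 2)) (Ioi 0) (Ioo (-1) 1) := by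
  refine InvOn.bijOn (f' := fun y ↦ √(r * (1 - y) / (1 + y))) ⟨fun v hv ↦ ?_, fun y hy ↦ ?_⟩
    (fun v hv ↦ ?_) fun y hy ↦ ?_
  · have hv : 0 < v := hv
    have hsub : 1 - (r - v ^ 2) / (r + v ^ 2) = 2 * v ^ 2 / (r + v ^ 2) := by
      field_simp
      ring
    have hadd : 1 + (r - v ^ 2) / (r + v ^ 2) = 2 * r / (r + v ^ 2) := by
      field_simp
      ring
    have hsq : r * (2 * v ^ 2 / (r + v ^ 2)) / (2 * r / (r + v ^ 2)) = v ^ 2 := by field_simp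
    simp only [hsub, hadd, hsq, Real.sqrt_sq hv.le]
  · have hsub : 0 < 1 - y := sub_pos.2 hy.2
    have hadd : 0 < 1 + y := by linarith [hy.1]
    simp only [Real.sq_sqrt (div_pos (mul_pos hr hsub) hadd).le]
    field_simp
    ring
  · have hv : 0 < v := hv
    constructor
    · rw [lt_div_iff₀ (by positivity)]
      linarith
    · rw [div_lt_one (by positivity)]
      linarith [pow_pos hv 2]
  · have hsub : 0 < 1 - y := sub_pos.2 hy.2
    have hadd : 0 < 1 + y := by linarith [hy.1]
    exact Real.sqrt_pos.2 (by positivity)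

theorem hasDerivAt_cayley_sq (hr : 0 < r) (v : ℝ) :
    HasDerivAt (fun v ↦ (r - v ^ 2) / (r + v ^ 2)) (-(4 * r * v / (r + v ^ 2) ^ 2)) v := by
  refine (((hasDerivAt_pow 2 v).const_sub r).fun_div ((hasDerivAt_pow 2 v).const_add r)
    (by positivity)).congr_deriv ?_
  field_simp
  ring

theorem one_sub_sq_mul_sq_le_biquadratic (r k v : ℝ) :
    (1 - k ^ 2) * (r + v ^ 2) ^ 2 ≤ (r + v ^ 2) ^ 2 - 4 * r * k ^ 2 * v ^ 2 := by
  linarith [mul_nonneg (sq_nonneg k) (sq_nonneg (r - v ^ 2))]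

theorem biquadratic_pos (hr : 0 < r) (hk : |k| < 1) (v : ℝ) :
    0 < (r + v ^ 2) ^ 2 - 4 * r * k ^ 2 * v ^ 2 := by
  have hk : 0 < 1 - k ^ 2 := sub_pos.2 ((sq_lt_one_iff_abs_lt_one k).2 hk)
  exact (one_sub_sq_mul_sq_le_biquadratic r k v).trans_lt' (by positivity)

theorem setIntegral_one_div_sqrt_biquadratic (hr : 0 < r) (hk : |k| < 1) :
    ∫ v in Ioi 0, 1 / √((r + v ^ 2) ^ 2 - 4 * r * k ^ 2 * v ^ 2) = ellipticK k / √r := by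
  have hsubst : ∫ y in Ioo (-1 : ℝ) 1, 1 / √((1 - y ^ 2) * (1 - k ^ 2 * (1 - y ^ 2))) =
      ∫ v in Ioi 0, 2 * √r * (1 / √((r + v ^ 2) ^ 2 - 4 * r * k ^ 2 * v ^ 2)) := by
    refine setIntegral_eq_of_bijOn measurableSet_Ioi (bijOn_cayley_sq hr)
      (fun v _ ↦ hasDerivAt_cayley_sq hr v) fun v hv ↦ ?_
    have hv : 0 < v := hv
    have hcubic : (1 - ((r - v ^ 2) / (r + v ^ 2)) ^ 2) *
        (1 - k ^ 2 * (1 - ((r - v ^ 2) / (r + v ^ 2)) ^ 2)) =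
        r * (2 * v / (r + v ^ 2) ^ 2) ^ 2 * ((r + v ^ 2) ^ 2 - 4 * r * k ^ 2 * v ^ 2) := by
      field_simp
      ring
    set q := (r + v ^ 2) ^ 2 - 4 * r * k ^ 2 * v ^ 2
    have hq : 0 < √q := Real.sqrt_pos.2 (biquadratic_pos hr hk v)
    have hroot : √r ^ 2 = r := Real.sq_sqrt hr.le
    rw [hcubic, Real.sqrt_mul (by positivity), Real.sqrt_mul hr.le, Real.sqrt_sq (by positivity),
      abs_neg, abs_of_pos (by positivity), smul_eq_mul]
    field_simp
    linear_combination -4 * hroot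
  rw [integral_const_mul, setIntegral_Ioo_neg_one_one_of_even fun y ↦ by rw [sq_abs],
    ← ellipticK_eq_setIntegral_complementary] at hsubst
  rw [eq_div_iff (by positivity)]
  linarith

theorem integrable_one_div_add_sq (hr : 0 < r) : Integrable fun v : ℝ ↦ 1 / (r + v ^ 2) := by
  have hroot : √r ^ 2 = r := Real.sq_sqrt hr.le
  refine ((integrable_inv_one_add_sq.comp_mul_left' (R := (√r)⁻¹) (by positivity)).const_mul
    r⁻¹).congr (.of_forall fun v ↦ ?_)
  simp only [mul_pow, inv_pow, hroot]
  field_simp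

theorem integrable_one_div_sqrt_biquadratic (hr : 0 < r) (hk : |k| < 1) :
    Integrable fun v : ℝ ↦ 1 / √((r + v ^ 2) ^ 2 - 4 * r * k ^ 2 * v ^ 2) := by
  have hk₀ : 0 < 1 - k ^ 2 := sub_pos.2 ((sq_lt_one_iff_abs_lt_one k).2 hk)
  have hmeas : Measurable fun v : ℝ ↦ 1 / √((r + v ^ 2) ^ 2 - 4 * r * k ^ 2 * v ^ 2) := by
    fun_prop
  refine ((integrable_one_div_add_sq hr).const_mul (1 / √(1 - k ^ 2))).mono'
    hmeas.aestronglyMeasurable (.of_forall fun v ↦ ?_)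
  rw [Real.norm_of_nonneg (by positivity), div_mul_div_comm, one_mul]
  refine one_div_le_one_div_of_le (by positivity) ?_
  refine Real.le_sqrt_of_sq_le ?_
  rw [mul_pow, Real.sq_sqrt hk₀.le]
  exact one_sub_sq_mul_sq_le_biquadratic r k v

/-- The period of the differential `√((1 - t) / t) dt / √(((1 - t)² + a²t²) ((1 - t)² + b²t²))`
along the real segment `[0, 1]`. -/
noncomputable def quarticPeriod (a b : ℝ) : ℝ :=
  ∫ t in Ioo (0 : ℝ) 1, √(1 - t) / √t /
    √(((1 - t) ^ 2 + a ^ 2 * t ^ 2) * ((1 - t) ^ 2 + b ^ 2 * t ^ 2))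

theorem bijOn_one_div_one_add_sq : BijOn (fun w : ℝ ↦ 1 / (1 + w ^ 2)) (Ioi 0) (Ioo 0 1) := by
  refine InvOn.bijOn (f' := fun t ↦ √(1 / t - 1)) ⟨fun w hw ↦ ?_, fun t ht ↦ ?_⟩
    (fun w hw ↦ ?_) fun t ht ↦ ?_
  · simp only [one_div_one_div, add_sub_cancel_left, Real.sqrt_sq (le_of_lt hw)]
  · have hinv : 0 ≤ 1 / t - 1 := sub_nonneg.2 (one_le_one_div ht.1 ht.2.le)
    simp only [Real.sq_sqrt hinv, add_sub_cancel, one_div_one_div]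
  · have hw : 0 < w := hw
    exact ⟨by positivity, (div_lt_one (by positivity)).2 (by linarith [pow_pos hw 2])⟩
  · exact Real.sqrt_pos.2 (sub_pos.2 (one_lt_one_div ht.1 ht.2))

theorem hasDerivAt_one_div_one_add_sq (w : ℝ) :
    HasDerivAt (fun w : ℝ ↦ 1 / (1 + w ^ 2)) (-(2 * w / (1 + w ^ 2) ^ 2)) w := by
  refine ((hasDerivAt_const w 1).fun_div ((hasDerivAt_pow 2 w).const_add 1)
    (by positivity)).congr_deriv ?_
  field_simp
  ring

theorem quarticPeriod_neg_neg (a b : ℝ) : quarticPeriod (-a) (-b) = quarticPeriod a b := by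
  simp only [quarticPeriod, neg_sq]

theorem quarticPeriod_eq_setIntegral_Ioi (a b : ℝ) :
    quarticPeriod a b = 2 * ∫ w in Ioi 0, w ^ 2 / √((w ^ 4 + a ^ 2) * (w ^ 4 + b ^ 2)) := by
  rw [quarticPeriod, ← integral_const_mul]
  refine setIntegral_eq_of_bijOn measurableSet_Ioi bijOn_one_div_one_add_sq
    (fun w _ ↦ hasDerivAt_one_div_one_add_sq w) fun w hw ↦ ?_
  have hw : 0 < w := hw
  have hsub : 1 - 1 / (1 + w ^ 2) = w ^ 2 * (1 / (1 + w ^ 2)) := by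
    field_simp
    ring
  have hquartic : ((w ^ 2 * (1 / (1 + w ^ 2))) ^ 2 + a ^ 2 * (1 / (1 + w ^ 2)) ^ 2) *
      ((w ^ 2 * (1 / (1 + w ^ 2))) ^ 2 + b ^ 2 * (1 / (1 + w ^ 2)) ^ 2) =
      (w ^ 4 + a ^ 2) * (w ^ 4 + b ^ 2) * (1 / (1 + w ^ 2) ^ 2) ^ 2 := by
    field_simp
  have hroot : √(1 / (1 + w ^ 2)) ≠ 0 := (Real.sqrt_pos.2 (by positivity)).ne'
  rw [hsub, hquartic, Real.sqrt_mul (sq_nonneg w), Real.sqrt_sq hw.le,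
    mul_div_cancel_right₀ _ hroot, Real.sqrt_mul (by positivity), Real.sqrt_sq (by positivity),
    abs_neg, abs_of_pos (by positivity), smul_eq_mul]
  field_simp

variable {a b : ℝ}

theorem abs_ellipticKMinus_modulus_lt_one (ha : 0 < a) (hb : 0 < b) :
    |(√a - √b) / √(2 * (a + b))| < 1 := by
  rw [← sq_lt_one_iff_abs_lt_one, div_pow, Real.sq_sqrt (by positivity),
    div_lt_one (by positivity)]
  have hsum : 0 < (√a + √b) ^ 2 := by positivity
  linarith [Real.sq_sqrt ha.le, Real.sq_sqrt hb.le]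

theorem quarticPeriod_eq (ha : 0 < a) (hb : 0 < b) :
    quarticPeriod a b = 2 / √(a + b) * ellipticKMinus a b := by
  set c := √(a * b) with hc
  set k := (√a - √b) / √(2 * (a + b)) with hk_def
  have hc₀ : 0 < c := Real.sqrt_pos.2 (by positivity)
  have hab : 0 < a + b := by positivity
  have hk : |k| < 1 := abs_ellipticKMinus_modulus_lt_one ha hb
  have hk_sq : 2 * (a + b) * k ^ 2 = a + b - 2 * c := by
    rw [hk_def, div_pow, Real.sq_sqrt (by positivity), sub_sq, Real.sq_sqrt ha.le,
      Real.sq_sqrt hb.le, hc, Real.sqrt_mul ha.le]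
    field_simp
    ring
  have hc_sq : c ^ 2 = a * b := Real.sq_sqrt (by positivity)
  rw [quarticPeriod_eq_setIntegral_Ioi, ellipticKMinus, ← hk_def, div_mul_eq_mul_div,
    mul_div_assoc, ← setIntegral_one_div_sqrt_biquadratic hab hk,
    ← setIntegral_Ioi_comp_sub_div (integrable_one_div_sqrt_biquadratic hab hk)
      (fun v ↦ by rw [sq_abs]) hc₀]
  congr 1
  refine setIntegral_congr_fun measurableSet_Ioi fun w hw ↦ ?_
  have hw : 0 < w := hw
  have hquartic : (a + b + (w - c / w) ^ 2) ^ 2 - 4 * (a + b) * k ^ 2 * (w - c / w) ^ 2 =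
      (w ^ 4 + a ^ 2) * (w ^ 4 + b ^ 2) / (w ^ 2) ^ 2 := by
    rw [show 4 * (a + b) * k ^ 2 = 2 * (a + b) - 4 * c by linarith]
    field_simp
    linear_combination (c ^ 2 + a * b - 2 * w ^ 4) * hc_sq
  rw [hquartic, Real.sqrt_div' _ (by positivity), Real.sqrt_sq (by positivity), one_div_div]

theorem ellipticKMinus_inv (ha : 0 < a) (hb : 0 < b) :
    ellipticKMinus a⁻¹ b⁻¹ = ellipticKMinus a b := by
  have hmodulus : (√a⁻¹ - √b⁻¹) / √(2 * (a⁻¹ + b⁻¹)) =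
      -((√a - √b) / √(2 * (a + b))) := by
    rw [show 2 * (a⁻¹ + b⁻¹) = 2 * (a + b) / (a * b) by field_simp; ring,
      Real.sqrt_inv, Real.sqrt_inv, Real.sqrt_div' _ (mul_pos ha hb).le, Real.sqrt_mul ha.le b]
    field_simp
    ring
  rw [ellipticKMinus, hmodulus, ellipticK_neg, ellipticKMinus]

end QuarticPeriod

section SpecialPoints

theorem setIntegral_Ioo_pos {a b : ℝ} (hab : a < b) {g : ℝ → ℝ} (hg : IntegrableOn g (Ioo a b))
    (hpos : ∀ t ∈ Ioo a b, 0 < g t) : 0 < ∫ t in Ioo a b, g t := by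
  rw [← integral_Ioc_eq_integral_Ioo, ← intervalIntegral.integral_of_le hab.le]
  exact intervalIntegral.intervalIntegral_pos_of_pos_on
    ((intervalIntegrable_iff_integrableOn_Ioo_of_le hab.le).2 hg) hpos hab

section RealIntegrand

variable {n : ℕ} {α γ : ℂ} {β : Fin n → ℂ} {x : Fin n → ℂ} {g : ℝ → ℝ}

theorem integrableOn_of_lauricellaIntegrand_eq (hα : 0 < α.re) (hγ : 0 < (γ - α).re)
    (hx : x ∈ lauricellaDomain n)
    (hg : ∀ t ∈ Ioo (0 : ℝ) 1, eulerWeight α γ t * lauricellaKernel β ((t : ℂ) • x) = g t) :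
    IntegrableOn g (Ioo 0 1) := by
  refine IntegrableOn.congr_fun (integrableOn_lauricellaIntegrand β hα hγ hx).re
    (fun t ht ↦ ?_) measurableSet_Ioo
  simp only [hg t ht, RCLike.re_eq_complex_re, Complex.ofReal_re]

theorem betaIntegral_mul_lauricellaFD_eq_ofReal (hα : 0 < α.re) (hγ : 0 < (γ - α).re)
    (hx : x ∈ lauricellaDomain n)
    (hg : ∀ t ∈ Ioo (0 : ℝ) 1, eulerWeight α γ t * lauricellaKernel β ((t : ℂ) • x) = g t) :
    Complex.betaIntegral α (γ - α) * lauricellaFD α β γ x = (∫ t in Ioo (0 : ℝ) 1, g t : ℝ) := by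
  rw [betaIntegral_mul_lauricellaFD β hα hγ hx, lauricellaIntegral,
    setIntegral_congr_fun measurableSet_Ioo hg]
  exact integral_ofReal

end RealIntegrand

theorem one_sub_ofReal (r : ℝ) : 1 - (r : ℂ) = (1 - r : ℝ) := by
  rw [Complex.ofReal_sub, Complex.ofReal_one]

theorem ofReal_cpow_half {r : ℝ} (hr : 0 ≤ r) : (r : ℂ) ^ (1 / 2 : ℂ) = √r := by
  rw [Real.sqrt_eq_rpow, Complex.ofReal_cpow hr]
  norm_num

theorem ofReal_cpow_neg_half {r : ℝ} (hr : 0 ≤ r) : (r : ℂ) ^ (-(1 / 2) : ℂ) = (1 / √r : ℝ) := by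
  rw [Complex.cpow_neg, ofReal_cpow_half hr, Complex.ofReal_div, Complex.ofReal_one, one_div]

theorem cpow_neg_half_mul_conj_cpow {z : ℂ} (hz : z ∈ Complex.slitPlane) :
    z ^ (-(1 / 2) : ℂ) * (starRingEnd ℂ z) ^ (-(1 / 2) : ℂ) = (1 / ‖z‖ : ℝ) := by
  have hexp : (-(1 / 2) : ℂ) = ((-(1 / 2) : ℝ) : ℂ) := by push_cast; rfl
  rw [hexp, Complex.conj_cpow _ _ (Complex.slitPlane_arg_ne_pi hz), Complex.conj_ofReal,
    Complex.mul_conj, Complex.normSq_eq_norm_sq, Complex.norm_cpow_real, ← Real.rpow_mul_natCast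
    (norm_nonneg z)]
  norm_num [Real.rpow_neg_one]

theorem betaIntegral_half_half : Complex.betaIntegral (1 / 2) (1 / 2) = Real.pi := by
  rw [Complex.betaIntegral_eq_Gamma_mul_div _ _ (by norm_num) (by norm_num), add_halves,
    Complex.Gamma_one, div_one, Complex.Gamma_one_half_eq,
    ← Complex.cpow_add _ _ (by exact_mod_cast Real.pi_ne_zero), add_halves, Complex.cpow_one]

theorem betaIntegral_threeHalves_half :
    Complex.betaIntegral (3 / 2) (1 / 2) = Real.pi / 2 := by
  have h := betaIntegral_add_nat (u := 1 / 2) (v := 1 / 2) (by norm_num) (by norm_num) 1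
  rw [betaIntegral_half_half, pochhammerSymbol, pochhammerSymbol, ascPochhammer_one,
    Polynomial.eval_X, Polynomial.eval_X, add_halves] at h
  rw [show (3 / 2 : ℂ) = 1 / 2 + (1 : ℕ) by norm_num, h]
  ring

theorem ofReal_mem_lauricellaDomain {n : ℕ} {x : Fin n → ℝ} (hx : ∀ i, x i < 1) :
    (fun i ↦ (x i : ℂ)) ∈ lauricellaDomain n := fun i ↦ by
  rw [one_sub_ofReal]
  exact Complex.ofReal_mem_slitPlane.2 (sub_pos.2 (hx i))

theorem lauricellaKernel_half_ofReal {n : ℕ} {x : Fin n → ℝ} (hx : ∀ i, x i ≤ 1) :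
    lauricellaKernel (fun _ ↦ 1 / 2) (fun i ↦ (x i : ℂ)) = (1 / √(∏ i, (1 - x i)) : ℝ) := by
  have hfactor (i : Fin n) : (1 - x i : ℂ) ^ (-(1 / 2) : ℂ) = ((√(1 - x i))⁻¹ : ℝ) := by
    rw [one_sub_ofReal, ofReal_cpow_neg_half (sub_nonneg.2 (hx i)), one_div]
  simp only [lauricellaKernel, hfactor]
  rw [Real.sqrt_prod _ fun i _ ↦ sub_nonneg.2 (hx i), one_div, ← Finset.prod_inv_distrib,
    Complex.ofReal_prod]

theorem ofReal_vec_three (x y z : ℝ) :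
    (fun i ↦ ((![x, y, z] i : ℝ) : ℂ)) = ![(x : ℂ), (y : ℂ), (z : ℂ)] := by
  ext i
  fin_cases i <;> rfl

theorem eulerWeight_half_integers (j : ℕ) {t : ℝ} (ht : t ∈ Ioo (0 : ℝ) 1) :
    eulerWeight (j + 1 / 2) (j + 1) t = (t ^ j / √(t * (1 - t)) : ℝ) := by
  have ht₀ : (t : ℂ) ≠ 0 := by exact_mod_cast ht.1.ne'
  rw [eulerWeight, show (j + 1 / 2 - 1 : ℂ) = j + -(1 / 2) by ring,
    show (j + 1 - (j + 1 / 2) - 1 : ℂ) = -(1 / 2) by ring, Complex.cpow_add _ _ ht₀,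
    Complex.cpow_natCast, ofReal_cpow_neg_half ht.1.le, one_sub_ofReal,
    ofReal_cpow_neg_half (sub_pos.2 ht.2).le, Real.sqrt_mul ht.1.le]
  push_cast
  field_simp

theorem eulerWeight_half_two {t : ℝ} (ht : t ∈ Ioo (0 : ℝ) 1) :
    eulerWeight (1 / 2) 2 t = (√(1 - t) / √t : ℝ) := by
  rw [eulerWeight, show (1 / 2 - 1 : ℂ) = -(1 / 2) by norm_num,
    show (2 - 1 / 2 - 1 : ℂ) = 1 / 2 by norm_num, ofReal_cpow_neg_half ht.1.le,
    one_sub_ofReal, ofReal_cpow_half (sub_pos.2 ht.2).le,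
    ← Complex.ofReal_mul, one_div_mul_eq_div]

section GenusTwo

variable {k : ℝ}

theorem genusTwo_mem_lauricellaDomain (hk : |k| < 1) :
    ![(-1 : ℂ), (k : ℂ), -(k : ℂ)] ∈ lauricellaDomain 3 := by
  have h := ofReal_mem_lauricellaDomain (x := ![-1, k, -k]) fun i ↦ by
    obtain ⟨hk₁, hk₂⟩ := abs_lt.1 hk
    fin_cases i <;> simp <;> linarith
  simpa only [ofReal_vec_three, Complex.ofReal_neg, Complex.ofReal_one] using h

theorem lauricellaKernel_genusTwo (hk : |k| ≤ 1) {t : ℝ} (ht : t ∈ Icc (0 : ℝ) 1) :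
    lauricellaKernel (fun _ ↦ 1 / 2) ((t : ℂ) • ![(-1 : ℂ), (k : ℂ), -(k : ℂ)]) =
      (1 / √((1 + t) * (1 - k ^ 2 * t ^ 2)) : ℝ) := by
  have hkt : |k * t| ≤ 1 := by
    rw [abs_mul, abs_of_nonneg ht.1]
    exact mul_le_one₀ hk ht.1 ht.2
  have hle (i : Fin 3) : ![-t, k * t, -(k * t)] i ≤ 1 := by
    obtain ⟨hkt₁, hkt₂⟩ := abs_le.1 hkt
    have ht₀ := ht.1
    fin_cases i <;> simp <;> linarith
  have hsmul : (t : ℂ) • ![(-1 : ℂ), (k : ℂ), -(k : ℂ)] =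
      fun i ↦ ((![-t, k * t, -(k * t)] i : ℝ) : ℂ) := by
    rw [ofReal_vec_three]
    simp [mul_comm]
  rw [hsmul, lauricellaKernel_half_ofReal hle, Fin.prod_univ_three]
  simp only [Matrix.cons_val]
  ring_nf

theorem lauricellaIntegrand_genusTwo (j : ℕ) (hk : |k| < 1) {t : ℝ} (ht : t ∈ Ioo (0 : ℝ) 1) :
    eulerWeight (j + 1 / 2) (j + 1) t *
        lauricellaKernel (fun _ ↦ 1 / 2) ((t : ℂ) • ![(-1 : ℂ), (k : ℂ), -(k : ℂ)]) =
      (t ^ j / √(genusTwoQuintic k t) : ℝ) := by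
  have hweight : 0 ≤ t * (1 - t) := (mul_pos ht.1 (sub_pos.2 ht.2)).le
  rw [eulerWeight_half_integers j ht, lauricellaKernel_genusTwo hk.le (Ioo_subset_Icc_self ht),
    ← Complex.ofReal_mul, div_mul_div_comm, mul_one, ← Real.sqrt_mul hweight, genusTwoQuintic]
  ring_nf

theorem re_natCast_add_half_pos (j : ℕ) : 0 < (j + 1 / 2 : ℂ).re := by
  norm_num
  positivity

theorem integrableOn_genusTwoPeriod (j : ℕ) (hk : |k| < 1) :
    IntegrableOn (fun t ↦ t ^ j / √(genusTwoQuintic k t)) (Ioo 0 1) :=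
  integrableOn_of_lauricellaIntegrand_eq (re_natCast_add_half_pos j) (by norm_num)
    (genusTwo_mem_lauricellaDomain hk) fun _ ht ↦ lauricellaIntegrand_genusTwo j hk ht

theorem genusTwoPeriod_pos (j : ℕ) (hk : |k| < 1) : 0 < genusTwoPeriod j k :=
  setIntegral_Ioo_pos one_pos (integrableOn_genusTwoPeriod j hk) fun _ ht ↦
    div_pos (pow_pos ht.1 j) (Real.sqrt_pos.2 (genusTwoQuintic_pos hk ht))

theorem betaIntegral_mul_lauricellaFD_genusTwo (j : ℕ) (hk : |k| < 1) :
    Complex.betaIntegral (j + 1 / 2) (1 / 2) * lauricellaFD (j + 1 / 2) (fun _ : Fin 3 ↦ 1 / 2)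
      (j + 1) ![(-1 : ℂ), (k : ℂ), -(k : ℂ)] = genusTwoPeriod j k := by
  have h := betaIntegral_mul_lauricellaFD_eq_ofReal (re_natCast_add_half_pos j) (by norm_num)
    (genusTwo_mem_lauricellaDomain hk) fun _ ht ↦ lauricellaIntegrand_genusTwo j hk ht
  rwa [show (j + 1 - (j + 1 / 2) : ℂ) = 1 / 2 by ring] at h

theorem lauricellaFD_half_one_genusTwo (hk : |k| < 1) :
    lauricellaFD (1 / 2) (fun _ : Fin 3 ↦ 1 / 2) 1 ![(-1 : ℂ), (k : ℂ), -(k : ℂ)] =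
      (genusTwoPeriod 0 k / Real.pi : ℝ) := by
  have h := betaIntegral_mul_lauricellaFD_genusTwo 0 hk
  rw [Nat.cast_zero, zero_add, zero_add, betaIntegral_half_half] at h
  rw [Complex.ofReal_div, eq_div_iff (by exact_mod_cast Real.pi_ne_zero), mul_comm, h]

theorem lauricellaFD_threeHalves_two_genusTwo (hk : |k| < 1) :
    lauricellaFD (3 / 2) (fun _ : Fin 3 ↦ 1 / 2) 2 ![(-1 : ℂ), (k : ℂ), -(k : ℂ)] =
      (2 * genusTwoPeriod 1 k / Real.pi : ℝ) := by
  have h := betaIntegral_mul_lauricellaFD_genusTwo 1 hk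
  rw [Nat.cast_one, show (1 + 1 / 2 : ℂ) = 3 / 2 by norm_num, one_add_one_eq_two,
    betaIntegral_threeHalves_half] at h
  rw [Complex.ofReal_div, Complex.ofReal_mul, eq_div_iff (by exact_mod_cast Real.pi_ne_zero),
    ← h, Complex.ofReal_ofNat]
  ring

theorem lauricellaFD_genusTwo_pfaff {α γ : ℂ} (hα : 0 < α.re) (hγ : 0 < (γ - α).re)
    (hk : |k| < 1) :
    lauricellaFD α (fun _ : Fin 3 ↦ 1 / 2) γ ![(-1 : ℂ), (k : ℂ), -(k : ℂ)] =
      (1 / √(2 * (1 - k ^ 2)) : ℝ) * lauricellaFD (γ - α) (fun _ : Fin 3 ↦ 1 / 2) γ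
        ![1 / 2, (k : ℂ) / (k - 1), (k : ℂ) / (k + 1)] := by
  have hkernel := lauricellaKernel_genusTwo hk.le (right_mem_Icc.2 zero_le_one)
  rw [Complex.ofReal_one, one_smul, one_pow, mul_one, one_add_one_eq_two] at hkernel
  rw [lauricellaFD_pfaff _ hα hγ (genusTwo_mem_lauricellaDomain hk), hkernel]
  congr 2
  ext i
  fin_cases i
  · norm_num
  · rfl
  · simp [neg_div, ← neg_add', ← div_neg, add_comm]

end GenusTwo

section Quartic

variable {a b : ℝ}

theorem conj_pairs_mem_lauricellaDomain (ha : a ≠ 0) (hb : b ≠ 0) :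
    ![1 + Complex.I * a, 1 - Complex.I * a, 1 + Complex.I * b, 1 - Complex.I * b] ∈
      lauricellaDomain 4 := fun i ↦ by
  refine Complex.mem_slitPlane_iff.2 (.inr ?_)
  fin_cases i <;> simpa

theorem norm_one_sub_mul_one_add_I_mul (t u : ℝ) :
    ‖(1 - t * (1 + Complex.I * u) : ℂ)‖ = √((1 - t) ^ 2 + u ^ 2 * t ^ 2) := by
  rw [Complex.norm_eq_sqrt_sq_add_sq]
  simp
  ring_nf

theorem lauricellaKernel_conj_pairs (ha : a ≠ 0) (hb : b ≠ 0) {t : ℝ} (ht : t ∈ Icc (0 : ℝ) 1) :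
    lauricellaKernel (fun _ ↦ 1 / 2) ((t : ℂ) • ![1 + Complex.I * a, 1 - Complex.I * a,
      1 + Complex.I * b, 1 - Complex.I * b]) =
      (1 / √(((1 - t) ^ 2 + a ^ 2 * t ^ 2) * ((1 - t) ^ 2 + b ^ 2 * t ^ 2)) : ℝ) := by
  have hmem := smul_mem_lauricellaDomain (conj_pairs_mem_lauricellaDomain ha hb) ht
  have hmem_a : 1 - t * (1 + Complex.I * a) ∈ Complex.slitPlane := hmem 0
  have hmem_b : 1 - t * (1 + Complex.I * b) ∈ Complex.slitPlane := hmem 2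
  have hconj (u : ℝ) : (1 - t * (1 - Complex.I * u) : ℂ) =
      starRingEnd ℂ (1 - t * (1 + Complex.I * u)) := by simp [sub_eq_add_neg]
  simp only [lauricellaKernel, Fin.prod_univ_four, Pi.smul_apply, smul_eq_mul, Matrix.cons_val,
    hconj]
  rw [cpow_neg_half_mul_conj_cpow hmem_a, mul_assoc, cpow_neg_half_mul_conj_cpow hmem_b,
    norm_one_sub_mul_one_add_I_mul, norm_one_sub_mul_one_add_I_mul, ← Complex.ofReal_mul,
    Real.sqrt_mul (by positivity), one_div_mul_one_div]

theorem lauricellaIntegrand_conj_pairs (ha : a ≠ 0) (hb : b ≠ 0) {t : ℝ}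
    (ht : t ∈ Ioo (0 : ℝ) 1) :
    eulerWeight (1 / 2) 2 t * lauricellaKernel (fun _ ↦ 1 / 2) ((t : ℂ) •
      ![1 + Complex.I * a, 1 - Complex.I * a, 1 + Complex.I * b, 1 - Complex.I * b]) =
      (√(1 - t) / √t /
        √(((1 - t) ^ 2 + a ^ 2 * t ^ 2) * ((1 - t) ^ 2 + b ^ 2 * t ^ 2)) : ℝ) := by
  rw [eulerWeight_half_two ht, lauricellaKernel_conj_pairs ha hb (Ioo_subset_Icc_self ht),
    ← Complex.ofReal_mul, mul_one_div]

theorem quarticPeriod_pos (ha : a ≠ 0) (hb : b ≠ 0) : 0 < quarticPeriod a b := by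
  refine setIntegral_Ioo_pos one_pos (integrableOn_of_lauricellaIntegrand_eq (by norm_num)
    (by norm_num) (conj_pairs_mem_lauricellaDomain ha hb)
    fun _ ht ↦ lauricellaIntegrand_conj_pairs ha hb ht) fun t ht ↦ ?_
  have ht₀ := ht.1
  have ht₁ : 0 < 1 - t := sub_pos.2 ht.2
  positivity

theorem lauricellaFD_half_two_conj_pairs (ha : a ≠ 0) (hb : b ≠ 0) :
    lauricellaFD (1 / 2) (fun _ : Fin 4 ↦ 1 / 2) 2
      ![1 + Complex.I * a, 1 - Complex.I * a, 1 + Complex.I * b, 1 - Complex.I * b] =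
      (2 * quarticPeriod a b / Real.pi : ℝ) := by
  have h := betaIntegral_mul_lauricellaFD_eq_ofReal (by norm_num) (by norm_num)
    (conj_pairs_mem_lauricellaDomain ha hb) fun _ ht ↦ lauricellaIntegrand_conj_pairs ha hb ht
  rw [← quarticPeriod, Complex.betaIntegral_symm, show (2 - 1 / 2 : ℂ) = 3 / 2 by norm_num,
    betaIntegral_threeHalves_half] at h
  rw [Complex.ofReal_div, Complex.ofReal_mul, eq_div_iff (by exact_mod_cast Real.pi_ne_zero),
    ← h, Complex.ofReal_ofNat]
  ring

theorem lauricellaFD_conj_pairs_pfaff {α γ : ℂ} (hα : 0 < α.re) (hγ : 0 < (γ - α).re)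
    (ha : a ≠ 0) (hb : b ≠ 0) :
    lauricellaFD α (fun _ : Fin 4 ↦ 1 / 2) γ
      ![1 + Complex.I * a, 1 - Complex.I * a, 1 + Complex.I * b, 1 - Complex.I * b] =
      (1 / |a * b| : ℝ) * lauricellaFD (γ - α) (fun _ : Fin 4 ↦ 1 / 2) γ
        ![1 + Complex.I * (-a⁻¹ : ℝ), 1 - Complex.I * (-a⁻¹ : ℝ),
          1 + Complex.I * (-b⁻¹ : ℝ), 1 - Complex.I * (-b⁻¹ : ℝ)] := by
  have hkernel := lauricellaKernel_conj_pairs ha hb (right_mem_Icc.2 zero_le_one)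
  rw [Complex.ofReal_one, one_smul, sub_self, zero_pow two_ne_zero, zero_add, zero_add, one_pow,
    mul_one, mul_one, ← mul_pow, Real.sqrt_sq_eq_abs] at hkernel
  rw [lauricellaFD_pfaff _ hα hγ (conj_pairs_mem_lauricellaDomain ha hb), hkernel]
  congr 2
  have hplus {u : ℝ} (hu : u ≠ 0) : (1 + Complex.I * u) / (1 + Complex.I * u - 1) =
      1 + Complex.I * (-u⁻¹ : ℝ) := by
    have hu' : (u : ℂ) ≠ 0 := Complex.ofReal_ne_zero.2 hu
    rw [add_sub_cancel_left, add_div, div_self (mul_ne_zero Complex.I_ne_zero hu'), add_comm,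
      one_div, mul_inv, Complex.inv_I, Complex.ofReal_neg, Complex.ofReal_inv, neg_mul_comm]
  have hminus {u : ℝ} (hu : u ≠ 0) : (1 - Complex.I * u) / (1 - Complex.I * u - 1) =
      1 - Complex.I * (-u⁻¹ : ℝ) := by
    simpa [sub_eq_add_neg] using hplus (neg_ne_zero.2 hu)
  ext i
  fin_cases i
  exacts [hplus ha, hminus ha, hplus hb, hminus hb]

end Quartic

end SpecialPoints

section EllipticEvaluations

variable {a b : ℝ}

theorem ellipticKMinus_pos (ha : 0 < a) (hb : 0 < b) : 0 < ellipticKMinus a b := by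
  have h := quarticPeriod_pos ha.ne' hb.ne'
  rw [quarticPeriod_eq ha hb] at h
  exact pos_of_mul_pos_right h (by positivity)

theorem abs_div_lt_one_of_pos_of_lt (hb : 0 < b) (hab : b < a) : |b / a| < 1 := by
  rw [abs_of_pos (div_pos hb (hb.trans hab))]
  exact (div_lt_one (hb.trans hab)).2 hab

theorem ellipticK_eq_genusTwoPeriod {s : ℝ} (hs : |s| < 1) :
    ellipticK ((1 + s) / √(2 * (1 + s ^ 2))) =
      √((1 + s ^ 2) / 2) * (genusTwoPeriod 0 (s ^ 2) + s * genusTwoPeriod 1 (s ^ 2)) := by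
  have hsq : |s ^ 2| < 1 := by
    rw [abs_pow]
    exact pow_lt_one₀ (abs_nonneg s) hs two_ne_zero
  rw [ellipticK_eq_genusTwo hs, genusTwoPeriod, genusTwoPeriod, ← integral_const_mul s,
    ← integral_add (integrableOn_genusTwoPeriod 0 hsq)
      ((integrableOn_genusTwoPeriod 1 hsq).const_mul s)]
  congr 2
  ext t
  ring

theorem ellipticK_eq_genusTwoPeriod_of_sq_eq_div (ha : 0 < a) (hb : 0 < b) {s : ℝ} (hs : |s| < 1)
    (hsq : s ^ 2 = b / a) :
    ellipticK (√a * (1 + s) / √(2 * (a + b))) =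
      √(a + b) / √(2 * a) * (genusTwoPeriod 0 (b / a) + s * genusTwoPeriod 1 (b / a)) := by
  have hmodulus : √a * (1 + s) / √(2 * (a + b)) = (1 + s) / √(2 * (1 + s ^ 2)) := by
    rw [hsq, show 2 * (a + b) = a * (2 * (1 + b / a)) by field_simp, Real.sqrt_mul ha.le,
      mul_div_mul_left _ _ (Real.sqrt_pos.2 ha).ne']
  rw [hmodulus, ellipticK_eq_genusTwoPeriod hs, hsq, ← Real.sqrt_div (by positivity)]
  congr 2
  field_simp

theorem abs_sqrt_div_sqrt_lt_one (hb : 0 < b) (hab : b < a) : |√b / √a| < 1 := by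
  rw [← Real.sqrt_div' _ (hb.trans hab).le, abs_of_nonneg (Real.sqrt_nonneg _),
    Real.sqrt_lt' one_pos, one_pow]
  exact (div_lt_one (hb.trans hab)).2 hab

theorem ellipticKPlus_eq_genusTwoPeriod (hb : 0 < b) (hab : b < a) :
    ellipticKPlus a b = √(a + b) / √(2 * a) *
      (genusTwoPeriod 0 (b / a) + √b / √a * genusTwoPeriod 1 (b / a)) := by
  have ha := hb.trans hab
  rw [← ellipticK_eq_genusTwoPeriod_of_sq_eq_div ha hb (abs_sqrt_div_sqrt_lt_one hb hab)
    (by rw [div_pow, Real.sq_sqrt hb.le, Real.sq_sqrt ha.le]), mul_add, mul_one,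
    mul_div_cancel₀ _ (Real.sqrt_pos.2 ha).ne', ellipticKPlus]

theorem ellipticKMinus_eq_genusTwoPeriod (hb : 0 < b) (hab : b < a) :
    ellipticKMinus a b = √(a + b) / √(2 * a) *
      (genusTwoPeriod 0 (b / a) - √b / √a * genusTwoPeriod 1 (b / a)) := by
  have ha := hb.trans hab
  rw [sub_eq_add_neg, ← neg_mul, ← ellipticK_eq_genusTwoPeriod_of_sq_eq_div ha hb
    (by rw [abs_neg]; exact abs_sqrt_div_sqrt_lt_one hb hab)
    (by rw [neg_sq, div_pow, Real.sq_sqrt hb.le, Real.sq_sqrt ha.le]), mul_add, mul_one,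
    mul_neg, mul_div_cancel₀ _ (Real.sqrt_pos.2 ha).ne', ← sub_eq_add_neg, ellipticKMinus]

theorem ellipticKPlus_add_ellipticKMinus (hb : 0 < b) (hab : b < a) :
    ellipticKPlus a b + ellipticKMinus a b =
      √(2 * (a + b)) / √a * genusTwoPeriod 0 (b / a) := by
  have ha := hb.trans hab
  have hroot : √2 ^ 2 = 2 := Real.sq_sqrt zero_le_two
  rw [ellipticKPlus_eq_genusTwoPeriod hb hab, ellipticKMinus_eq_genusTwoPeriod hb hab,
    Real.sqrt_mul zero_le_two, Real.sqrt_mul zero_le_two]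
  field_simp
  rw [hroot]
  ring

theorem ellipticKPlus_sub_ellipticKMinus (hb : 0 < b) (hab : b < a) :
    ellipticKPlus a b - ellipticKMinus a b =
      √(2 * (b * (a + b))) / a * genusTwoPeriod 1 (b / a) := by
  have ha := hb.trans hab
  have hroot : √2 ^ 2 = 2 := Real.sq_sqrt zero_le_two
  have hroot_a : √a ^ 2 = a := Real.sq_sqrt ha.le
  rw [ellipticKPlus_eq_genusTwoPeriod hb hab, ellipticKMinus_eq_genusTwoPeriod hb hab,
    Real.sqrt_mul zero_le_two, Real.sqrt_mul zero_le_two, Real.sqrt_mul hb.le]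
  field_simp
  rw [hroot, hroot_a]
  ring

theorem ellipticKPlus_add_ellipticKMinus_pos (hb : 0 < b) (hab : b < a) :
    0 < ellipticKPlus a b + ellipticKMinus a b := by
  have ha := hb.trans hab
  have hperiod := genusTwoPeriod_pos 0 (abs_div_lt_one_of_pos_of_lt hb hab)
  rw [ellipticKPlus_add_ellipticKMinus hb hab]
  positivity

theorem ellipticKPlus_sub_ellipticKMinus_pos (hb : 0 < b) (hab : b < a) :
    0 < ellipticKPlus a b - ellipticKMinus a b := by
  have ha := hb.trans hab
  have hperiod := genusTwoPeriod_pos 1 (abs_div_lt_one_of_pos_of_lt hb hab)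
  rw [ellipticKPlus_sub_ellipticKMinus hb hab]
  positivity

end EllipticEvaluations

section LauricellaEvaluations

variable {a b : ℝ}

theorem lauricellaFD_half_two_conj_pairs_eq_ellipticKMinus (ha : 0 < a) (hb : 0 < b) :
    lauricellaFD (1 / 2) (fun _ : Fin 4 ↦ 1 / 2) 2
      ![1 + Complex.I * a, 1 - Complex.I * a, 1 + Complex.I * b, 1 - Complex.I * b] =
      (4 / √(a + b) * ellipticKMinus a b / Real.pi : ℝ) := by
  rw [lauricellaFD_half_two_conj_pairs ha.ne' hb.ne', quarticPeriod_eq ha hb]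
  congr 1
  ring

theorem lauricellaFD_threeHalves_two_conj_pairs_eq_ellipticKMinus (ha : 0 < a) (hb : 0 < b) :
    lauricellaFD (3 / 2) (fun _ : Fin 4 ↦ 1 / 2) 2
      ![1 + Complex.I * a, 1 - Complex.I * a, 1 + Complex.I * b, 1 - Complex.I * b] =
      (4 / √(a * b * (a + b)) * ellipticKMinus a b / Real.pi : ℝ) := by
  have hsum : √(a⁻¹ + b⁻¹) = √(a + b) / √(a * b) := by
    rw [← Real.sqrt_div' _ (mul_pos ha hb).le]
    congr 1
    field_simp
    ring
  have hroot : √(a * b) ^ 2 = a * b := Real.sq_sqrt (mul_pos ha hb).le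
  rw [lauricellaFD_conj_pairs_pfaff (by norm_num) (by norm_num) ha.ne' hb.ne',
    show (2 - 3 / 2 : ℂ) = 1 / 2 by norm_num,
    lauricellaFD_half_two_conj_pairs (neg_ne_zero.2 (inv_pos.2 ha).ne')
      (neg_ne_zero.2 (inv_pos.2 hb).ne'),
    quarticPeriod_neg_neg, quarticPeriod_eq (inv_pos.2 ha) (inv_pos.2 hb),
    ellipticKMinus_inv ha hb, hsum, ← Complex.ofReal_mul, Real.sqrt_mul (mul_pos ha hb).le,
    abs_of_pos (mul_pos ha hb)]
  congr 1
  field_simp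
  rw [hroot]
  ring

theorem lauricellaFD_half_one_genusTwo_eq_ellipticK (hb : 0 < b) (hab : b < a) :
    lauricellaFD (1 / 2) (fun _ : Fin 3 ↦ 1 / 2) 1 ![-1, (b : ℂ) / a, -((b : ℂ) / a)] =
      (√a / √(2 * (a + b)) * (ellipticKPlus a b + ellipticKMinus a b) / Real.pi : ℝ) := by
  have ha := hb.trans hab
  rw [← Complex.ofReal_div,
    lauricellaFD_half_one_genusTwo (abs_div_lt_one_of_pos_of_lt hb hab),
    ellipticKPlus_add_ellipticKMinus hb hab]
  field_simp

theorem lauricellaFD_threeHalves_two_genusTwo_eq_ellipticK (hb : 0 < b) (hab : b < a) :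
    lauricellaFD (3 / 2) (fun _ : Fin 3 ↦ 1 / 2) 2 ![-1, (b : ℂ) / a, -((b : ℂ) / a)] =
      (√2 * a / √(b * (a + b)) * (ellipticKPlus a b - ellipticKMinus a b) / Real.pi : ℝ) := by
  have ha := hb.trans hab
  have hroot : √2 ^ 2 = 2 := Real.sq_sqrt zero_le_two
  rw [← Complex.ofReal_div,
    lauricellaFD_threeHalves_two_genusTwo (abs_div_lt_one_of_pos_of_lt hb hab),
    ellipticKPlus_sub_ellipticKMinus hb hab, Real.sqrt_mul zero_le_two]
  field_simp
  rw [hroot, mul_comm]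

theorem lauricellaFD_reflected_eq {α γ : ℂ} (hα : 0 < α.re) (hγ : 0 < (γ - α).re)
    (hb : 0 < b) (hab : b < a) :
    lauricellaFD (γ - α) (fun _ : Fin 3 ↦ 1 / 2) γ
      ![1 / 2, (b : ℂ) / (a + b), (b : ℂ) / (b - a)] =
      (√2 * √(a - b) * √(a + b) / a : ℝ) * lauricellaFD α (fun _ : Fin 3 ↦ 1 / 2) γ
        ![-1, ((-(b / a) : ℝ) : ℂ), -((-(b / a) : ℝ) : ℂ)] := by
  have ha := hb.trans hab
  have hd := sub_pos.2 hab
  have ha' : (a : ℂ) ≠ 0 := Complex.ofReal_ne_zero.2 ha.ne'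
  have hroot : √(2 * (1 - (-(b / a)) ^ 2)) = √2 * √(a - b) * √(a + b) / a := by
    rw [← Real.sqrt_mul zero_le_two, ← Real.sqrt_mul (mul_pos two_pos hd).le,
      show 2 * (1 - (-(b / a)) ^ 2) = 2 * (a - b) * (a + b) / a ^ 2 by field_simp; ring,
      Real.sqrt_div' _ (sq_nonneg a), Real.sqrt_sq ha.le]
  have hplus : ((-(b / a) : ℝ) : ℂ) / ((-(b / a) : ℝ) - 1) = b / (a + b) := by
    push_cast
    rw [← neg_add', neg_div_neg_eq, div_add_one ha', div_div_div_cancel_right₀ ha', add_comm]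
  have hminus : ((-(b / a) : ℝ) : ℂ) / ((-(b / a) : ℝ) + 1) = b / (b - a) := by
    push_cast
    rw [neg_div, ← div_neg, neg_add', neg_neg, div_sub_one ha', div_div_div_cancel_right₀ ha']
  rw [lauricellaFD_genusTwo_pfaff hα hγ (by rw [abs_neg]; exact abs_div_lt_one_of_pos_of_lt hb hab),
    hroot, hplus, hminus, ← mul_assoc, ← Complex.ofReal_mul, mul_one_div_cancel (by positivity),
    Complex.ofReal_one, one_mul]

theorem lauricellaFD_half_one_reflected_eq_ellipticK (hb : 0 < b) (hab : b < a) :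
    lauricellaFD (1 / 2) (fun _ : Fin 3 ↦ 1 / 2) 1
      ![1 / 2, (b : ℂ) / (a + b), (b : ℂ) / (b - a)] =
      (√(a - b) / √a * (ellipticKPlus a b + ellipticKMinus a b) / Real.pi : ℝ) := by
  have ha := hb.trans hab
  have hroot : √a ^ 2 = a := Real.sq_sqrt ha.le
  have h := lauricellaFD_reflected_eq (α := 1 / 2) (γ := 1) (by norm_num) (by norm_num) hb hab
  rw [show (1 - 1 / 2 : ℂ) = 1 / 2 by norm_num] at h
  rw [h, lauricellaFD_half_one_genusTwo
    (by rw [abs_neg]; exact abs_div_lt_one_of_pos_of_lt hb hab), genusTwoPeriod_neg,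
    ellipticKPlus_add_ellipticKMinus hb hab, ← Complex.ofReal_mul, Real.sqrt_mul zero_le_two]
  congr 1
  field_simp
  rw [hroot]
  ring

theorem lauricellaFD_half_two_reflected_eq_ellipticK (hb : 0 < b) (hab : b < a) :
    lauricellaFD (1 / 2) (fun _ : Fin 3 ↦ 1 / 2) 2
      ![1 / 2, (b : ℂ) / (a + b), (b : ℂ) / (b - a)] =
      (2 * √(a - b) / √b * (ellipticKPlus a b - ellipticKMinus a b) / Real.pi : ℝ) := by
  have ha := hb.trans hab
  have h := lauricellaFD_reflected_eq (α := 3 / 2) (γ := 2) (by norm_num) (by norm_num) hb hab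
  rw [show (2 - 3 / 2 : ℂ) = 1 / 2 by norm_num] at h
  rw [h, lauricellaFD_threeHalves_two_genusTwo
    (by rw [abs_neg]; exact abs_div_lt_one_of_pos_of_lt hb hab), genusTwoPeriod_neg,
    ellipticKPlus_sub_ellipticKMinus hb hab, ← Complex.ofReal_mul, Real.sqrt_mul zero_le_two,
    Real.sqrt_mul hb.le]
  congr 1
  field_simp

theorem pi_eq_mul_div {F : ℂ} {c K : ℝ} (hF : F = (c * K / Real.pi : ℝ)) (hc : 0 < c)
    (hK : 0 < K) : (Real.pi : ℂ) = c * (K / F) := by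
  have hc' : (c : ℂ) ≠ 0 := by exact_mod_cast hc.ne'
  have hK' : (K : ℂ) ≠ 0 := by exact_mod_cast hK.ne'
  rw [hF]
  push_cast
  field_simp

end LauricellaEvaluations

theorem theorem3p2 (a b : ℝ) (hb : 0 < b) (hab : b < a) :
    (Real.pi : ℂ) =
      ((4 / Real.sqrt (a * b * (a + b)) : ℝ) : ℂ) *
        ((ellipticKMinus a b : ℝ) /
          lauricellaFD (3 / 2) (fun _ : Fin 4 => 1 / 2) 2
            ![1 + Complex.I * a, 1 - Complex.I * a, 1 + Complex.I * b, 1 - Complex.I * b]) ∧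
    (Real.pi : ℂ) =
      ((4 / Real.sqrt (a + b) : ℝ) : ℂ) *
        ((ellipticKMinus a b : ℝ) /
          lauricellaFD (1 / 2) (fun _ : Fin 4 => 1 / 2) 2
            ![1 + Complex.I * a, 1 - Complex.I * a, 1 + Complex.I * b, 1 - Complex.I * b]) ∧
    (Real.pi : ℂ) =
      ((2 * Real.sqrt (a - b) / Real.sqrt b : ℝ) : ℂ) *
        ((ellipticKPlus a b - ellipticKMinus a b : ℝ) /
          lauricellaFD (1 / 2) (fun _ : Fin 3 => 1 / 2) 2
            ![1 / 2, (b : ℂ) / (a + b), (b : ℂ) / (b - a)]) ∧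
    (Real.pi : ℂ) =
      ((Real.sqrt (a - b) / Real.sqrt a : ℝ) : ℂ) *
        ((ellipticKPlus a b + ellipticKMinus a b : ℝ) /
          lauricellaFD (1 / 2) (fun _ : Fin 3 => 1 / 2) 1
            ![1 / 2, (b : ℂ) / (a + b), (b : ℂ) / (b - a)]) ∧
    (Real.pi : ℂ) =
      ((Real.sqrt a / Real.sqrt (2 * (a + b)) : ℝ) : ℂ) *
        ((ellipticKPlus a b + ellipticKMinus a b : ℝ) /
          lauricellaFD (1 / 2) (fun _ : Fin 3 => 1 / 2) 1
            ![-1, (b : ℂ) / a, -((b : ℂ) / a)]) ∧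
    (Real.pi : ℂ) =
      ((Real.sqrt 2 * a / Real.sqrt (b * (a + b)) : ℝ) : ℂ) *
        ((ellipticKPlus a b - ellipticKMinus a b : ℝ) /
          lauricellaFD (3 / 2) (fun _ : Fin 3 => 1 / 2) 2
            ![-1, (b : ℂ) / a, -((b : ℂ) / a)]) := by
  have ha : 0 < a := hb.trans hab
  have : 0 < a - b := sub_pos.2 hab
  have hminus := ellipticKMinus_pos ha hb
  have hsub := ellipticKPlus_sub_ellipticKMinus_pos hb hab
  have hadd := ellipticKPlus_add_ellipticKMinus_pos hb hab
  exact ⟨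
    pi_eq_mul_div (lauricellaFD_threeHalves_two_conj_pairs_eq_ellipticKMinus ha hb)
      (by positivity) hminus,
    pi_eq_mul_div (lauricellaFD_half_two_conj_pairs_eq_ellipticKMinus ha hb)
      (by positivity) hminus,
    pi_eq_mul_div (lauricellaFD_half_two_reflected_eq_ellipticK hb hab) (by positivity) hsub,
    pi_eq_mul_div (lauricellaFD_half_one_reflected_eq_ellipticK hb hab) (by positivity) hadd,
    pi_eq_mul_div (lauricellaFD_half_one_genusTwo_eq_ellipticK hb hab) (by positivity) hadd,
    pi_eq_mul_div (lauricellaFD_threeHalves_two_genusTwo_eq_ellipticK hb hab)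
      (by positivity) hsub⟩
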